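/- All groups are finite, and a class of groups is closed under isomorphism. Let $\pi$ be a set of primes, $\pi'$ the complementary set of primes. A group is a $\pi$-group if all prime divisors of its order lie in $\pi$. Let $\mathfrak N^\pi$ be the class of all direct products $H\times K$ of a $\pi$-group $H$ and a nilpotent $\pi'$-group $K$. For a group $G$, let $G^{\mathfrak N^\pi}$ be the smallest normal subgroup of $G$ with quotient in $\mathfrak N^\pi$, and $O^\pi(G)$ the smallest normal subgroup of $G$ whose quotient is a $\pi$-group. $G$ is $\pi'$-soluble if each of its composition factors is a $\pi$-group or a $\pi'$-group, and each composition factor that is a $\pi'$-group is a $p$-group for some prime $p\in\pi'$. A subgroup $H\le G$ is $\mathfrak N^\pi$-Dnormal in $G$ if for every prime $p$ and every Sylow $p$-subgroup $G_p$ of $G$ such that $G_p\cap H$ is a Sylow $p$-subgroup of $H$: $G_p\le N_G(H)$ if $p\in\pi'$ or $\pi=\{p\}$; and $G_p\le N_G(O^\pi(H))$ if $p\in\pi$ and $|\pi|\ge 2$. A non-empty class $\mathfrak F$ of groups is an $\mathfrak N^\pi$-Fitting class if (i) whenever $G\in\mathfrak F$ and $N$ is $\mathfrak N^\pi$-Dnormal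 in $G$, then $N\in\mathfrak F$; and (ii) whenever $M,N\in\mathfrak F$ are $\mathfrak N^\pi$-Dnormal subgroups of $G=\langle M,N\rangle$, then $G\in\mathfrak F$. An $\mathfrak F$-injector of $G$ is a subgroup $V\le G$ such that, for every subnormal subgroup $K$ of $G$, $V\cap K$ is maximal (with respect to inclusion) among the subgroups of $K$ that belong to $\mathfrak F$. **Corollary.** Let $\mathfrak F$ be an $\mathfrak N^\pi$-Fitting class and let $G$ be a $\pi'$-soluble group. Then the $\mathfrak F$-injectors of $G$ form exactly one (non-empty) conjugacy class of subgroups of $G$. Moreover, if $V$ and $V^*$ are $\mathfrak F$-injectors of $G$, there exists $g\in G^{\mathfrak N^\pi}$ such that $(V^*)^g=g^{-1}V^*g=V$. Also, if $I$ is an $\mathfrak F$-injector of $G$ and $N$ is an $\mathfrak N^\pi$-Dnormal subgroup of $G$, then $I\cap N$ is an $\mathfrak F$-injector of $N$. -/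

import Mathlib

open scoped Pointwise

universe u

namespace NPiFitting

/-- A class of finite groups: a property of finite groups that is invariant under isomorphism. -/
structure GroupClass where
  /-- `Mem X` says that the group `X` belongs to the class. -/
  Mem : (X : Type u) → [Group X] → Prop
  finite_of_mem : ∀ (X : Type u) [Group X], Mem X → Finite X
  mem_of_mulEquiv : ∀ (X Y : Type u) [Group X] [Group Y], X ≃* Y → Mem X → Mem Y

/-- The class of all finite `π`-groups: every prime divisor of the order lies in `π`. -/
def piGroups (π : Set Nat.Primes) : GroupClass.{u} where
  Mem X _ := Finite X ∧ ∀ p : Nat.Primes, (p : ℕ) ∣ Nat.card X → p ∈ π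
  finite_of_mem _ _ h := h.1
  mem_of_mulEquiv X Y _ _ e h := by
    have := h.1
    refine ⟨Finite.of_equiv X e.toEquiv, fun p hp => h.2 p ?_⟩
    rwa [Nat.card_congr e.toEquiv]

/-- The class of all direct products `H × K` with `H` a finite `π`-group and `K` a finite nilpotent
`π'`-group, where `π'` is the set of primes not in `π`. -/
def nPi (π : Set Nat.Primes) : GroupClass.{u} where
  Mem X _ := ∃ (H K : Type u) (_ : Group H) (_ : Group K),
    (piGroups π).Mem H ∧ (piGroups πᶜ).Mem K ∧ Group.IsNilpotent K ∧ Nonempty (X ≃* H × K)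
  finite_of_mem X _ := by
    rintro ⟨H, K, _, _, hH, hK, -, ⟨e⟩⟩
    have := hH.1
    have := hK.1
    exact Finite.of_equiv (H × K) e.symm.toEquiv
  mem_of_mulEquiv X Y _ _ f := by
    rintro ⟨H, K, iH, iK, hH, hK, hn, ⟨e⟩⟩
    exact ⟨H, K, iH, iK, hH, hK, hn, ⟨f.symm.trans e⟩⟩

/-- The residual of `G` for a class `X`: the intersection of all normal subgroups of `G` whose
quotient group lies in `X`. For the classes `piGroups π` and `nPi π`, which are formations, and
finite `G` this is the smallest normal subgroup with quotient in the class. -/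
def residual (X : GroupClass.{u}) (G : Type u) [Group G] : Subgroup G :=
  sInf {N : Subgroup G | ∃ _ : N.Normal, X.Mem (G ⧸ N)}

/-- The subgroup `O^π(H)` of a subgroup `H` of `G`, regarded as a subgroup of `G`. -/
def upperO (π : Set Nat.Primes) {G : Type u} [Group G] (H : Subgroup G) : Subgroup G :=
  (residual (piGroups π) H).map H.subtype

/-- A composition series `1 = s 0 ⊴ s 1 ⊴ ⋯ ⊴ s n = G`, with simple factors. -/
def IsCompositionSeries {G : Type u} [Group G] {n : ℕ} (s : Fin (n + 1) → Subgroup G) : Prop :=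
  s 0 = ⊥ ∧ s (Fin.last n) = ⊤ ∧
    ∀ i : Fin n, s i.castSucc ≤ s i.succ ∧
      ∃ _ : ((s i.castSucc).subgroupOf (s i.succ)).Normal,
        IsSimpleGroup (s i.succ ⧸ (s i.castSucc).subgroupOf (s i.succ))

/-- `Q` is (isomorphic to) a composition factor of `G`. -/
def IsCompositionFactor (Q G : Type u) [Group Q] [Group G] : Prop :=
  ∃ (n : ℕ) (s : Fin (n + 1) → Subgroup G), IsCompositionSeries s ∧
    ∃ (i : Fin n) (_ : ((s i.castSucc).subgroupOf (s i.succ)).Normal),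
      Nonempty (Q ≃* s i.succ ⧸ (s i.castSucc).subgroupOf (s i.succ))

/-- `ρ`-separable: every composition factor is a `ρ`-group or a `ρ'`-group. -/
def IsPiSeparable (ρ : Set Nat.Primes) (G : Type u) [Group G] : Prop :=
  ∀ (Q : Type u) [Group Q], IsCompositionFactor Q G →
    (piGroups ρ).Mem Q ∨ (piGroups ρᶜ).Mem Q

/-- `ρ`-soluble: `ρ`-separable, and every composition factor that is a `ρ`-group is a `p`-group
for some `p ∈ ρ`. -/
def IsPiSoluble (ρ : Set Nat.Primes) (G : Type u) [Group G] : Prop :=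
  IsPiSeparable ρ G ∧
    ∀ (Q : Type u) [Group Q], IsCompositionFactor Q G → (piGroups ρ).Mem Q →
      ∃ p ∈ ρ, IsPGroup (p : ℕ) Q

/-- The Sylow subgroup `P` of `G` reduces into `H`: `P ∩ H` is a Sylow `p`-subgroup of `H`. -/
def ReducesInto {G : Type u} [Group G] {p : ℕ} (P : Sylow p G) (H : Subgroup G) : Prop :=
  ∃ Q : Sylow p H, (Q : Subgroup H) = (P : Subgroup G).subgroupOf H

/-- `H` is `𝔑^π`-Dnormal in `G`. -/
def IsDNormal (π : Set Nat.Primes) {G : Type u} [Group G] (H : Subgroup G) : Prop :=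
  (∀ p ∈ πᶜ, ∀ P : Sylow (p : ℕ) G, ReducesInto P H →
    (P : Subgroup G) ≤ Subgroup.normalizer (H : Set G)) ∧
  (∀ p ∈ π, ∀ P : Sylow (p : ℕ) G, ReducesInto P H →
    (π = {p} → (P : Subgroup G) ≤ Subgroup.normalizer (H : Set G)) ∧
    (2 ≤ π.encard → (P : Subgroup G) ≤ Subgroup.normalizer (upperO π H : Set G)))

/-- `F` is an `𝔑^π`-Fitting class. -/
structure IsNPiFittingClass (π : Set Nat.Primes) (F : GroupClass.{u}) : Prop where
  nonempty : ∃ (X : Type u) (_ : Group X), F.Mem X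
  mem_of_isDNormal : ∀ (G : Type u) [Group G], F.Mem G →
    ∀ N : Subgroup G, IsDNormal π N → F.Mem N
  mem_of_join : ∀ (G : Type u) [Group G] [Finite G] (M N : Subgroup G),
    IsDNormal π M → IsDNormal π N → M ⊔ N = ⊤ → F.Mem M → F.Mem N → F.Mem G

/-- `V` is an `F`-injector of `G`: for every subnormal subgroup `K` of `G`, the subgroup `V ∩ K` is
maximal among the subgroups of `K` that belong to `F`. -/
def IsInjector (F : GroupClass.{u}) {G : Type u} [Group G] (V : Subgroup G) : Prop :=
  ∀ K : Subgroup G, K.IsSubnormal →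
    Maximal (fun U : Subgroup G => U ≤ K ∧ F.Mem U) (V ⊓ K)

/-- The conjugate `V^g = g⁻¹ V g`. -/
def conjBy {G : Type u} [Group G] (V : Subgroup G) (g : G) : Subgroup G :=
  MulAut.conj g⁻¹ • V

end NPiFitting

/-! Split the primes into the blocks `π` and `{p}` with `p ∉ π`. A `π'`-soluble group has the
property `HasBlockFactors`: every non-trivial subgroup has a proper normal subgroup whose index
involves one block only. The theory of injectors in soluble groups (Fischer, Gaschütz, Hartley) can
then be run with blocks in place of primes.

What the class must supply is collected in `IsFittingSet`. Besides closure under conjugation, normal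
subgroups and normal products, the decisive axiom is `unique`: if `H` normalizes `D` and `H / D`
belongs to one block, then `H` has at most one maximal member above `D`. For a single prime this
comes from the growth of normalizers in `p`-groups. If `π` has at least two elements, every subgroup
above a normal subgroup of `π`-index is Dnormal, so two members above `D` generate a member.

Relative Hall subgroups for each block exist and dominate (`HasBlockFactors.hallDominated`).
Together with `unique` this gives `exists_conj_of_normal`: for `N` normal in `K` with index in one
block, the maximal members of `K` above a given maximal member of `N` are conjugate under `N`.
Conjugacy of injectors follows by induction. For existence, a maximal member of `K` above an
injector of `N` has to be tested against a second normal subgroup `M`. If the indices of `N` and `M`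
lie in different blocks, suitable maximal members of `N` and `M` commute modulo their common part
(`exists_commutator_conj_le`), so their product is again a member.

The conjugating element can be chosen in `O^ρ(G)` for each block `ρ`. These subgroups have pairwise
coprime indices, and a Chinese remainder argument moves it into an intersection that lies in the
`𝔑^π`-residual.

For a Dnormal `N` and `|π| ≥ 2`, `N` is normalized by a normal subgroup `A` of `π`-index. Injectors
restrict to `NA`, and then to its normal subgroup `N`. If `|π| ≤ 1`, Dnormal subgroups are normal.
-/

namespace NPiFitting

open Subgroup
open scoped commutatorElement

/-! ### Numbers whose prime divisors lie in a given set. -/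

section Arithmetic

/-- All prime divisors of `n` lie in `ρ`. -/
def IsPiNumber (ρ : Set Nat.Primes) (n : ℕ) : Prop := ∀ p : Nat.Primes, (p : ℕ) ∣ n → p ∈ ρ

variable {ρ τ : Set Nat.Primes} {m n : ℕ}

lemma IsPiNumber.of_dvd (h : IsPiNumber ρ n) (hmn : m ∣ n) : IsPiNumber ρ m :=
  fun p hp => h p (hp.trans hmn)

lemma IsPiNumber.mul (hm : IsPiNumber ρ m) (hn : IsPiNumber ρ n) : IsPiNumber ρ (m * n) :=
  fun p hp => ((Nat.Prime.dvd_mul p.2).1 hp).elim (hm p) (hn p)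

lemma IsPiNumber.mono (h : IsPiNumber ρ n) (hρ : ρ ⊆ τ) : IsPiNumber τ n :=
  fun p hp => hρ (h p hp)

lemma isPiNumber_one : IsPiNumber ρ 1 := fun p hp => absurd (Nat.dvd_one.1 hp) p.2.ne_one

lemma IsPiNumber.coprime (hm : IsPiNumber ρ m) (hn : IsPiNumber τ n) (h : Disjoint ρ τ) :
    Nat.Coprime m n :=
  Nat.coprime_of_dvd fun p hp h1 h2 =>
    Set.disjoint_left.1 h (hm ⟨p, hp⟩ h1) (hn ⟨p, hp⟩ h2)

lemma IsPiNumber.eq_one (h : IsPiNumber ρ n) (h' : IsPiNumber ρᶜ n) : n = 1 :=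
  (Nat.coprime_self n).1 (h.coprime h' disjoint_compl_right)

lemma isPiNumber_prime {p : Nat.Primes} : IsPiNumber {p} (p : ℕ) := fun q hq =>
  Subtype.ext ((Nat.prime_dvd_prime_iff_eq q.2 p.2).1 hq)

lemma isPiNumber_prime_pow {p : Nat.Primes} (k : ℕ) : IsPiNumber {p} ((p : ℕ) ^ k) := fun q hq =>
  Subtype.ext ((Nat.prime_dvd_prime_iff_eq q.2 p.2).1 (q.2.dvd_of_dvd_pow hq))

lemma IsPiNumber.eq_prime_pow {p : Nat.Primes} (h : IsPiNumber {p} n) (hn : n ≠ 0) :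
    ∃ k, n = (p : ℕ) ^ k :=
  ⟨_, Nat.eq_prime_pow_of_unique_prime_dvd hn fun {q} hq hqn =>
    congrArg Subtype.val (show (⟨q, hq⟩ : Nat.Primes) = p from h ⟨q, hq⟩ hqn)⟩

end Arithmetic

/-! ### Conjugates, normalizers and relative indices. -/

section Subgroups

variable {G : Type u} [Group G]

lemma mem_conj_smul {g x : G} {U : Subgroup G} : x ∈ MulAut.conj g • U ↔ g⁻¹ * x * g ∈ U := by
  rw [Subgroup.mem_pointwise_smul_iff_inv_smul_mem, ← map_inv, MulAut.smul_def, MulAut.conj_apply,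
    inv_inv]

lemma conj_mem_conj_smul {g x : G} {U : Subgroup G} :
    g * x * g⁻¹ ∈ MulAut.conj g • U ↔ x ∈ U := by
  rw [mem_conj_smul]; simp [mul_assoc]

lemma conj_smul_conj_smul (g h : G) (U : Subgroup G) :
    MulAut.conj g • MulAut.conj h • U = MulAut.conj (g * h) • U := by
  rw [smul_smul, ← map_mul]

lemma conj_inv_smul_conj_smul (g : G) (U : Subgroup G) :
    MulAut.conj g⁻¹ • MulAut.conj g • U = U := by
  rw [conj_smul_conj_smul]; simp

lemma conj_smul_conj_inv_smul (g : G) (U : Subgroup G) :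
    MulAut.conj g • MulAut.conj g⁻¹ • U = U := by
  rw [conj_smul_conj_smul]; simp

lemma mem_normalizer_iff_conj_smul {g : G} {U : Subgroup G} :
    g ∈ normalizer (U : Set G) ↔ MulAut.conj g • U = U := by
  rw [mem_normalizer_iff'', SetLike.ext_iff]
  simp only [mem_conj_smul]
  exact ⟨fun h x => (h x).symm, fun h x => (h x).symm⟩

lemma conj_smul_eq {g : G} {U : Subgroup G} (h : g ∈ normalizer (U : Set G)) :
    MulAut.conj g • U = U := mem_normalizer_iff_conj_smul.1 h

lemma conj_smul_le {g : G} {U K : Subgroup G} (h : U ≤ K) (hg : g ∈ normalizer (K : Set G)) :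
    MulAut.conj g • U ≤ K :=
  (Subgroup.pointwise_smul_le_pointwise_smul_iff.2 h).trans (conj_smul_eq hg).le

lemma le_conj_smul {g : G} {U K : Subgroup G} (h : K ≤ U) (hg : g ∈ normalizer (K : Set G)) :
    K ≤ MulAut.conj g • U :=
  (conj_smul_eq hg).ge.trans (Subgroup.pointwise_smul_le_pointwise_smul_iff.2 h)

lemma normalizer_conj_smul (g : G) (U : Subgroup G) :
    normalizer ((MulAut.conj g • U : Subgroup G) : Set G) =
      MulAut.conj g • normalizer (U : Set G) := by
  ext x
  rw [mem_conj_smul, mem_normalizer_iff_conj_smul, mem_normalizer_iff_conj_smul,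
    ← smul_left_cancel_iff (MulAut.conj g) (x := MulAut.conj (g⁻¹ * x * g) • U),
    conj_smul_conj_smul, conj_smul_conj_smul]
  simp [mul_assoc]

lemma le_normalizer_inf {K A B : Subgroup G} (hA : K ≤ normalizer (A : Set G))
    (hB : K ≤ normalizer (B : Set G)) : K ≤ normalizer ((A ⊓ B : Subgroup G) : Set G) :=
  (le_inf hA hB).trans inf_normalizer_le_normalizer_inf

lemma le_normalizer_sup {K A B : Subgroup G} (hA : K ≤ normalizer (A : Set G))
    (hB : K ≤ normalizer (B : Set G)) : K ≤ normalizer ((A ⊔ B : Subgroup G) : Set G) :=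
  (le_inf hA hB).trans (normalizer_inf_normalizer_le_normalizer_sup A B)

lemma mem_sup_of_le_normalizer {A B : Subgroup G} (h : A ≤ normalizer (B : Set G)) {x : G} :
    x ∈ A ⊔ B ↔ ∃ a ∈ A, ∃ b ∈ B, a * b = x := by
  rw [← SetLike.mem_coe, coe_mul_of_left_le_normalizer_right A B h]
  simp [Set.mem_mul]

lemma mem_sup_of_le_normalizer' {A B : Subgroup G} (h : A ≤ normalizer (B : Set G)) {x : G} :
    x ∈ A ⊔ B ↔ ∃ b ∈ B, ∃ a ∈ A, b * a = x := by
  rw [sup_comm, ← SetLike.mem_coe, coe_mul_of_right_le_normalizer_left B A h]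
  simp [Set.mem_mul]

/-- Dedekind's modular law. -/
lemma sup_inf_of_le {A B C : Subgroup G} (h : A ≤ normalizer (B : Set G)) (hB : B ≤ C) :
    (A ⊔ B) ⊓ C = (A ⊓ C) ⊔ B := by
  apply le_antisymm
  · rintro x ⟨hx, hxC⟩
    obtain ⟨a, ha, b, hb, rfl⟩ := (mem_sup_of_le_normalizer h).1 hx
    have : a ∈ C := by simpa using C.mul_mem hxC (C.inv_mem (hB hb))
    exact mul_mem (mem_sup_left ⟨ha, this⟩) (mem_sup_right hb)
  · exact sup_le (le_inf (inf_le_left.trans le_sup_left) inf_le_right) (le_inf le_sup_right hB)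

lemma relIndex_sup_of_le_normalizer {A B : Subgroup G} (h : A ≤ normalizer (B : Set G)) :
    B.relIndex (A ⊔ B) = B.relIndex A := by
  have hn : (B.subgroupOf (A ⊔ B)).Normal :=
    normal_subgroupOf_of_le_normalizer (sup_le h le_normalizer)
  have h1 := relIndex_sup_right (K := B.subgroupOf (A ⊔ B)) (H := A.subgroupOf (A ⊔ B))
  rw [← subgroupOf_sup le_sup_left le_sup_right, relIndex_subgroupOf le_sup_left,
    relIndex_subgroupOf le_rfl] at h1
  exact h1

/-- `UN / N` is a subgroup of `KN / N`; `N` need not lie in `U` or `K`. -/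
lemma relIndex_dvd_of_le_normalizer {N U K : Subgroup G} (hU : U ≤ K)
    (hK : K ≤ normalizer (N : Set G)) : N.relIndex U ∣ N.relIndex K := by
  rw [← relIndex_sup_of_le_normalizer (hU.trans hK), ← relIndex_sup_of_le_normalizer hK]
  exact ⟨_, (by rw [relIndex_mul_relIndex _ _ _ le_sup_right (sup_le_sup_right hU N)])⟩

lemma eq_of_le_of_relIndex_eq_one {A B : Subgroup G} (h : A ≤ B) (h1 : A.relIndex B = 1) : A = B :=
  le_antisymm h (relIndex_eq_one.1 h1)

lemma card_conj_smul (g : G) (U : Subgroup G) :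
    Nat.card (MulAut.conj g • U : Subgroup G) = Nat.card U := by
  exact (Nat.card_congr (Subgroup.equivSMul (MulAut.conj g) U).toEquiv).symm

variable [Finite G]

lemma relIndex_ne_zero' (A B : Subgroup G) : A.relIndex B ≠ 0 :=
  index_ne_zero_of_finite

lemma relIndex_sup_of_le_normalizer' {A B : Subgroup G} (h : A ≤ normalizer (B : Set G)) :
    A.relIndex (A ⊔ B) = A.relIndex B := by
  have h1 := relIndex_mul_relIndex (A ⊓ B) A (A ⊔ B) inf_le_left le_sup_left
  have h2 := relIndex_mul_relIndex (A ⊓ B) B (A ⊔ B) inf_le_right le_sup_right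
  rw [inf_relIndex_left] at h1
  rw [inf_relIndex_right, relIndex_sup_of_le_normalizer h, ← h1, mul_comm] at h2
  exact (Nat.eq_of_mul_eq_mul_left (Nat.pos_of_ne_zero (relIndex_ne_zero' _ _)) h2).symm

lemma card_lt_card {A B : Subgroup G} (h : A < B) : Nat.card A < Nat.card B :=
  Set.Finite.card_lt_card (Set.toFinite (B : Set G)) h

end Subgroups

/-! ### Complements of abelian normal Hall subgroups. -/

section SchurZassenhaus

open MulAction MulOpposite

variable {Q : Type u} [Group Q] [Finite Q]

omit [Finite Q] in
/-- A subgroup `U` that meets the normal subgroup `M` trivially stabilises a left transversal of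
`M` under right multiplication. -/
lemma exists_leftTransversal_stabilized (M U : Subgroup Q) [M.Normal] (hU : U ⊓ M = ⊥) :
    ∃ S : M.LeftTransversal, ∀ u ∈ U, op u • S = S := by
  obtain ⟨R, hR, -⟩ := (U ⊔ M).exists_isComplement_left 1
  -- `R` is a transversal of `UM` and `U` one of `M` in `UM`, so `RU` is a transversal of `M`. It is
  -- visibly stable under right multiplication by `U`.
  have hS : IsComplement (R * (U : Set Q)) (M : Set Q) := by
    rw [isComplement_iff_existsUnique_inv_mul_mem]
    intro g
    obtain ⟨⟨r, hr⟩, h1, -⟩ := (isComplement_iff_existsUnique_inv_mul_mem.1 hR) g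
    obtain ⟨v, hv, m, hm, hvm⟩ := (mem_sup_of_le_normalizer (B := M) le_normalizer_of_normal).1 h1
    refine ⟨⟨r * v, Set.mul_mem_mul hr hv⟩, ?_, ?_⟩
    · have : (r * v)⁻¹ * g = m := by
        rw [mul_inv_rev, mul_assoc]
        simp only at hvm
        rw [← hvm]; simp
      simp only [this]
      exact hm
    · rintro ⟨_, r', hr', v', hv', rfl⟩ h2
      simp only at h2 hvm
      have hrr : r' = r := by
        have := (isComplement_iff_existsUnique_inv_mul_mem.1 hR g).unique (y₁ := ⟨r', hr'⟩)
          (y₂ := ⟨r, hr⟩) ?_ h1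
        · simpa using this
        · have : r'⁻¹ * g = v' * ((r' * v')⁻¹ * g) := by group
          simp only [SetLike.mem_coe]
          rw [this]
          exact mul_mem (mem_sup_left hv') (mem_sup_right h2)
      subst hrr
      have h3 : v'⁻¹ * v ∈ U ⊓ M := by
        refine ⟨U.mul_mem (U.inv_mem hv') hv, ?_⟩
        have : v'⁻¹ * v = (r' * v')⁻¹ * g * m⁻¹ := by
          have : g = r' * (v * m) := by rw [hvm]; group
          rw [this]; group
        rw [this]
        exact M.mul_mem h2 (M.inv_mem hm)
      rw [hU, mem_bot, inv_mul_eq_one] at h3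
      simp [h3]
  refine ⟨⟨_, hS⟩, fun u hu => Subtype.ext ?_⟩
  change op u • (R * (U : Set Q)) = _
  have hle : ∀ v ∈ U, op v • (R * (U : Set Q)) ⊆ R * (U : Set Q) := by
    rintro v hv _ ⟨_, ⟨r, hr, w, hw, rfl⟩, rfl⟩
    exact ⟨r, hr, w * v, U.mul_mem hw hv, (mul_assoc r w v).symm⟩
  refine (hle u hu).antisymm ?_
  rw [Set.subset_smul_set_iff, ← op_inv]
  exact hle _ (U.inv_mem hu)

/-- **Schur–Zassenhaus** for an abelian normal Hall subgroup: there is a complement containing a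
conjugate of each subgroup that meets the normal subgroup trivially. -/
theorem exists_complement_dominating (M : Subgroup Q) [M.Normal] [IsMulCommutative M]
    (hM : Nat.Coprime (Nat.card M) M.index) :
    ∃ C : Subgroup Q, IsComplement' M C ∧
      ∀ U : Subgroup Q, U ⊓ M = ⊥ → ∃ m ∈ M, MulAut.conj m • U ≤ C := by
  let β : M.QuotientDiff := default
  refine ⟨stabilizer Q β, isComplement'_stabilizer_of_coprime hM, fun U hU => ?_⟩
  obtain ⟨S, hS⟩ := exists_leftTransversal_stabilized M U hU
  -- The complement is the stabilizer of the class `β` of transversals. `U` fixes the class `α` of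
  -- its invariant transversal, and `M` is transitive on classes, so an `M`-conjugate of `U` fixes
  -- `β`.
  let α : M.QuotientDiff := Quotient.mk'' S
  have hα : U ≤ stabilizer Q α := by
    intro v hv
    change Quotient.mk'' (op v⁻¹ • S) = Quotient.mk'' S
    rw [hS _ (inv_mem hv)]
  obtain ⟨m, hm⟩ := exists_smul_eq hM α β
  refine ⟨m, m.2, fun x hx => ?_⟩
  rw [mem_conj_smul] at hx
  have h1 := hα hx
  rw [mem_stabilizer_iff] at h1 ⊢
  have h2 : (m : Q) • α = β := hm
  rw [← h2]
  conv_rhs => rw [← h1]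
  simp only [smul_smul]
  congr 1
  group

/-- The relative form of `exists_complement_dominating`, modulo a normal subgroup `D`. -/
theorem exists_relative_complement_dominating {G : Type u} [Group G] [Finite G]
    {D E H : Subgroup G} (hDE : D ≤ E) (hEH : E ≤ H) (hD : H ≤ normalizer (D : Set G))
    (hE : H ≤ normalizer (E : Set G)) (hcomm : ⁅E, E⁆ ≤ D)
    (hcop : Nat.Coprime (D.relIndex E) (E.relIndex H)) :
    ∃ C : Subgroup G, D ≤ C ∧ C ≤ H ∧ C ⊔ E = H ∧ C ⊓ E = D ∧
      ∀ U : Subgroup G, D ≤ U → U ≤ H → U ⊓ E = D → ∃ e ∈ E, MulAut.conj e • U ≤ C := by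
  have hDn : (D.subgroupOf H).Normal := normal_subgroupOf_of_le_normalizer hD
  have hEn : (E.subgroupOf H).Normal := normal_subgroupOf_of_le_normalizer hE
  let φ : H →* H ⧸ D.subgroupOf H := QuotientGroup.mk' _
  have hφ : Function.Surjective φ := QuotientGroup.mk'_surjective _
  have hker : ∀ x : H, φ x = 1 ↔ (x : G) ∈ D := fun x => by
    simp only [φ, QuotientGroup.mk'_apply, QuotientGroup.eq_one_iff, mem_subgroupOf]
  have hkerφ : φ.ker = D.subgroupOf H := QuotientGroup.ker_mk' _
  let M := (E.subgroupOf H).map φ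
  have hMn : M.Normal := hEn.map φ hφ
  have hMmem : ∀ x : H, φ x ∈ M ↔ (x : G) ∈ E := by
    intro x
    refine ⟨?_, fun hx => ⟨x, hx, rfl⟩⟩
    rintro ⟨y, hy, hyx⟩
    have : φ (y⁻¹ * x) = 1 := by rw [map_mul, map_inv, hyx, inv_mul_cancel]
    have h2 := E.mul_mem hy (hDE ((hker _).1 this))
    simpa using h2
  have hMc : IsMulCommutative M := by
    refine ⟨⟨?_⟩⟩
    rintro ⟨_, a, ha, rfl⟩ ⟨_, b, hb, rfl⟩
    refine Subtype.ext ?_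
    change φ a * φ b = φ b * φ a
    rw [← mul_inv_eq_one, ← map_mul, ← map_mul, ← map_inv, ← map_mul, hker]
    have := hcomm (commutator_mem_commutator ha hb)
    rw [commutatorElement_def] at this
    simpa [mul_assoc] using this
  have hidx : M.index = E.relIndex H := by
    refine index_map_eq _ hφ ?_
    rw [hkerφ]
    exact fun x hx => hDE hx
  have hcard : Nat.card M = D.relIndex E := by
    have h1 := relIndex_ker (K := E.subgroupOf H) φ
    rw [hkerφ, relIndex_subgroupOf hEH] at h1
    exact h1.symm
  obtain ⟨C, hC, hdom⟩ := exists_complement_dominating M (by rwa [hidx, hcard])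
  have hmem : ∀ x : H, (x : G) ∈ (C.comap φ).map H.subtype ↔ φ x ∈ C := by
    intro x
    refine ⟨?_, fun hx => ⟨x, hx, rfl⟩⟩
    rintro ⟨y, hy, hyx⟩
    rwa [← Subtype.ext (show (y : G) = x from hyx)]
  have hCH : (C.comap φ).map H.subtype ≤ H := map_subtype_le _
  have hDC : D ≤ (C.comap φ).map H.subtype := by
    intro d hd
    refine (hmem ⟨d, hEH (hDE hd)⟩).2 ?_
    rw [(hker _).2 hd]; exact C.one_mem
  refine ⟨_, hDC, hCH, ?_, ?_, ?_⟩
  · apply le_antisymm (sup_le hCH hEH)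
    intro x hx
    obtain ⟨⟨⟨m, hm⟩, ⟨c, hc⟩⟩, hmc, -⟩ := (isComplement'_def.1 hC).existsUnique (φ ⟨x, hx⟩)
    obtain ⟨e, he, rfl⟩ := hm
    have : φ (e⁻¹ * ⟨x, hx⟩) = c := by
      rw [map_mul, map_inv, ← hmc]
      simp
    have h2 : ((e⁻¹ * ⟨x, hx⟩ : H) : G) ∈ (C.comap φ).map H.subtype :=
      (hmem _).2 (by rw [this]; exact hc)
    have h3 := (((C.comap φ).map H.subtype) ⊔ E).mul_mem (mem_sup_right he) (mem_sup_left h2)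
    simpa using h3
  · apply le_antisymm
    · rintro x ⟨hx, hxE⟩
      have hxH := hCH hx
      have h1 := (hmem ⟨x, hxH⟩).1 hx
      have h2 := (hMmem ⟨x, hxH⟩).2 hxE
      have h3 : φ ⟨x, hxH⟩ ∈ (⊥ : Subgroup _) := hC.disjoint.le_bot ⟨h2, h1⟩
      exact (hker _).1 (mem_bot.1 h3)
    · exact le_inf hDC hDE
  · intro U hDU hUH hUE
    obtain ⟨_, ⟨e, he, rfl⟩, hle⟩ := hdom ((U.subgroupOf H).map φ) (by
      rw [eq_bot_iff]
      rintro _ ⟨⟨x, hx, rfl⟩, hxM⟩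
      have : (x : G) ∈ U ⊓ E := ⟨hx, (hMmem x).1 hxM⟩
      rw [hUE] at this
      exact mem_bot.2 ((hker _).2 this))
    refine ⟨e, he, fun x hx => ?_⟩
    rw [mem_conj_smul] at hx
    let y : H := ⟨_, hUH hx⟩
    have hy : φ (e * y * e⁻¹) ∈ C := by
      apply hle
      rw [map_mul, map_mul, map_inv, conj_mem_conj_smul]
      exact ⟨y, hx, rfl⟩
    have := (hmem _).2 hy
    simpa [y, mul_assoc] using this

end SchurZassenhaus

/-! ### Blocks of primes and normal subgroups with index in one block. -/

section BlockFactors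

/-- The partition of the set of primes into `π` and the singletons outside `π`. -/
def blocks (π : Set Nat.Primes) : Set (Set Nat.Primes) := {ρ | ρ = π ∨ ∃ p ∉ π, ρ = {p}}

lemma disjoint_of_mem_blocks {π ρ τ : Set Nat.Primes} (hρ : ρ ∈ blocks π) (hτ : τ ∈ blocks π)
    (h : ρ ≠ τ) : Disjoint ρ τ := by
  obtain rfl | ⟨p, hp, rfl⟩ := hρ <;> obtain rfl | ⟨q, hq, rfl⟩ := hτ
  · exact absurd rfl h
  · exact Set.disjoint_singleton_right.2 hq
  · exact Set.disjoint_singleton_left.2 hp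
  · exact Set.disjoint_singleton.2 fun hpq => h (by rw [hpq])

/-- Every non-trivial subgroup `K` has a proper normal subgroup whose index is a `π`-number or a
prime outside `π`. -/
def HasBlockFactors (π : Set Nat.Primes) (G : Type u) [Group G] : Prop :=
  ∀ K : Subgroup G, K ≠ ⊥ → ∃ N < K, K ≤ normalizer (N : Set G) ∧
    (IsPiNumber π (N.relIndex K) ∨ ∃ p ∉ π, N.relIndex K = (p : ℕ))

lemma exists_block {π : Set Nat.Primes} {n : ℕ}
    (h : IsPiNumber π n ∨ ∃ p ∉ π, n = ((p : Nat.Primes) : ℕ)) : ∃ ρ ∈ blocks π, IsPiNumber ρ n := by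
  obtain h | ⟨p, hp, rfl⟩ := h
  · exact ⟨π, Or.inl rfl, h⟩
  · exact ⟨{p}, Or.inr ⟨p, hp, rfl⟩, isPiNumber_prime⟩

variable {π : Set Nat.Primes} {G : Type u} [Group G] [Finite G]

/-- The property passes to the quotient `K / E`. Take a minimal supplement `A` of `E` in `K` and a
normal subgroup `N` of `A` as provided: `NE` is normal in `K`, and proper because `A` is minimal. -/
lemma HasBlockFactors.exists_normal_between (hG : HasBlockFactors π G) {E K : Subgroup G}
    (hEK : E < K) (hE : K ≤ normalizer (E : Set G)) :
    ∃ M, E ≤ M ∧ M < K ∧ K ≤ normalizer (M : Set G) ∧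
      (IsPiNumber π (M.relIndex K) ∨ ∃ p ∉ π, M.relIndex K = (p : ℕ)) := by
  obtain ⟨A, -, ⟨hAK, hAE⟩, hmin⟩ := Finite.exists_le_minimal
    (p := fun A : Subgroup G => A ≤ K ∧ A ⊔ E = K) (a := K) ⟨le_rfl, sup_eq_left.2 hEK.le⟩
  have hA : A ≠ ⊥ := by
    rintro rfl
    rw [bot_sup_eq] at hAE
    exact hEK.ne hAE
  obtain ⟨N, hNA, hN, hidx⟩ := hG A hA
  have hAM : A ≤ normalizer ((N ⊔ E : Subgroup G) : Set G) :=
    le_normalizer_sup hN (hAK.trans hE)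
  have hKM : K ≤ normalizer ((N ⊔ E : Subgroup G) : Set G) := by
    rw [← hAE]
    exact sup_le hAM (le_sup_right.trans le_normalizer)
  have hMK : N ⊔ E < K := by
    refine lt_of_le_of_ne (sup_le (hNA.le.trans hAK) hEK.le) fun h => ?_
    exact hNA.not_ge (hmin ⟨hNA.le.trans hAK, h⟩ hNA.le)
  have hdvd : (N ⊔ E).relIndex K ∣ N.relIndex A := by
    have : A ⊔ (N ⊔ E) = K := by rw [← sup_assoc, sup_eq_left.2 hNA.le, hAE]
    rw [← this, relIndex_sup_of_le_normalizer hAM]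
    exact relIndex_dvd_of_le_left _ le_sup_left
  refine ⟨N ⊔ E, le_sup_right, hMK, hKM, hidx.imp (fun h => h.of_dvd hdvd) ?_⟩
  rintro ⟨p, hp, h⟩
  refine ⟨p, hp, ((Nat.dvd_prime p.2).1 (h ▸ hdvd)).resolve_left fun h1 => ?_⟩
  exact hMK.not_ge (relIndex_eq_one.1 h1)

omit [Finite G] in
lemma isPiNumber_relIndex_inf {ρ : Set Nat.Primes} {A B E : Subgroup G}
    (hA : E ≤ normalizer (A : Set G)) (h1 : IsPiNumber ρ (A.relIndex E))
    (h2 : IsPiNumber ρ (B.relIndex E)) : IsPiNumber ρ ((A ⊓ B).relIndex E) := by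
  rw [← relIndex_inf_mul_relIndex]
  exact (h1.of_dvd (relIndex_dvd_of_le_normalizer inf_le_right hA)).mul h2

/-- A normal subgroup of `E` with `ρ`-index contains a `T`-invariant one. -/
lemma exists_invariant_le {ρ : Set Nat.Primes} {D E M T : Subgroup G} (hDM : D ≤ M) (hME : M ≤ E)
    (hM : E ≤ normalizer (M : Set G)) (hρ : IsPiNumber ρ (M.relIndex E))
    (hTD : T ≤ normalizer (D : Set G)) (hTE : T ≤ normalizer (E : Set G)) :
    ∃ E', D ≤ E' ∧ E' ≤ M ∧ T ≤ normalizer (E' : Set G) ∧ IsPiNumber ρ (E'.relIndex E) := by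
  obtain ⟨E', hE'M, ⟨hDE', hE'E, hE'n, hE'ρ⟩, hmin⟩ := Finite.exists_le_minimal
    (p := fun A : Subgroup G => D ≤ A ∧ A ≤ E ∧ E ≤ normalizer (A : Set G) ∧
      IsPiNumber ρ (A.relIndex E)) (a := M) ⟨hDM, hME, hM, hρ⟩
  refine ⟨E', hDE', hE'M, fun t ht => ?_, hE'ρ⟩
  have hn : E ≤ normalizer ((MulAut.conj t • E' : Subgroup G) : Set G) := by
    rw [normalizer_conj_smul]
    exact le_conj_smul hE'n (hTE ht)
  -- The intersection of `E'` with its conjugate is again normal of `ρ`-index in `E`, so minimality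
  -- puts `E'` inside the conjugate; equal orders do the rest.
  have h1 : E' ≤ MulAut.conj t • E' := by
    refine (hmin ⟨le_inf hDE' (le_conj_smul hDE' (hTD ht)), inf_le_left.trans hE'E,
      le_normalizer_inf hE'n hn, isPiNumber_relIndex_inf hE'n hE'ρ ?_⟩ inf_le_left).trans
      inf_le_right
    conv => enter [2, 2]; rw [← conj_smul_eq (hTE ht)]
    rwa [relIndex_pointwise_smul]
  rw [mem_normalizer_iff_conj_smul]
  exact (Subgroup.eq_of_le_of_card_ge h1 (card_conj_smul _ _).le).symm

end BlockFactors

/-! ### Hall subgroups of sections, and the case of one prime. -/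

section Hall

variable {π : Set Nat.Primes} {G : Type u} [Group G] [Finite G]

/-- `H / D` is a Hall `ρ`-subgroup of `K / D`. -/
structure IsHallOver (ρ : Set Nat.Primes) (D K H : Subgroup G) : Prop where
  le : D ≤ H
  le' : H ≤ K
  isPiNumber : IsPiNumber ρ (D.relIndex H)
  isPiNumber_compl : IsPiNumber ρᶜ (H.relIndex K)

/-- `K / D` has a Hall `ρ`-subgroup that contains a conjugate of each `ρ`-subgroup. -/
def HallDominated (ρ : Set Nat.Primes) (D K : Subgroup G) : Prop :=
  ∃ H, IsHallOver ρ D K H ∧ ∀ U, D ≤ U → U ≤ K → IsPiNumber ρ (D.relIndex U) →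
    ∃ k ∈ K, MulAut.conj k • U ≤ H

lemma isPiNumber_natCard_iff {p : Nat.Primes} {P : Subgroup G} :
    IsPiNumber {p} (Nat.card P) ↔ IsPGroup (p : ℕ) P := by
  have := Fact.mk p.2
  rw [IsPGroup.iff_card]
  constructor
  · exact fun h => h.eq_prime_pow Nat.card_pos.ne'
  · rintro ⟨k, hk⟩
    rw [hk]
    exact isPiNumber_prime_pow k

lemma exists_sylow_in (p : Nat.Primes) (K : Subgroup G) :
    ∃ P ≤ K, IsPiNumber {p} (Nat.card P) ∧ IsPiNumber {p}ᶜ (P.relIndex K) ∧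
      ∀ Q ≤ K, IsPiNumber {p} (Nat.card Q) → ∃ k ∈ K, MulAut.conj k • Q ≤ P := by
  have := Fact.mk p.2
  obtain ⟨P⟩ : Nonempty (Sylow p K) := inferInstance
  refine ⟨(P : Subgroup K).map K.subtype, map_subtype_le _, ?_, ?_, ?_⟩
  · exact isPiNumber_natCard_iff.2 (P.2.map _)
  · intro q hq hqp
    rw [Set.mem_singleton_iff] at hqp
    subst hqp
    have h1 : ((P : Subgroup K).map K.subtype).relIndex K = (P : Subgroup K).index := by
      rw [relIndex, subgroupOf, comap_map_eq_self_of_injective K.subtype_injective]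
    exact P.not_dvd_index (h1 ▸ hq)
  · intro Q hQK hQ
    obtain ⟨P', hP'⟩ := ((isPiNumber_natCard_iff.1 hQ).comap_subtype (K := K)).exists_le_sylow
    obtain ⟨k, hk⟩ := MulAction.exists_smul_eq K P' P
    refine ⟨k, k.2, fun x hx => ?_⟩
    rw [mem_conj_smul] at hx
    let y : K := ⟨_, hQK hx⟩
    have hy : y ∈ (P' : Subgroup K) := hP' hx
    refine ⟨k * y * k⁻¹, ?_, ?_⟩
    · rw [← hk]
      exact conj_mem_conj_smul.2 hy
    · simp [y, mul_assoc]

lemma hallDominated_singleton (p : Nat.Primes) {D K : Subgroup G} (hDK : D ≤ K)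
    (hD : K ≤ normalizer (D : Set G)) : HallDominated {p} D K := by
  obtain ⟨P, hPK, hP, hPK', hdom⟩ := exists_sylow_in p K
  refine ⟨P ⊔ D, ⟨le_sup_right, sup_le hPK hDK, ?_, ?_⟩, fun U hDU hUK hU => ?_⟩
  · rw [relIndex_sup_of_le_normalizer (hPK.trans hD)]
    exact hP.of_dvd (relIndex_dvd_card _ _)
  · exact hPK'.of_dvd (relIndex_dvd_of_le_left _ le_sup_left)
  · obtain ⟨Q, hQU, hQ, hQU', -⟩ := exists_sylow_in p U
    obtain ⟨k, hk, hle⟩ := hdom Q (hQU.trans hUK) hQ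
    have hUQ : U ≤ Q ⊔ D := by
      refine relIndex_eq_one.1 (IsPiNumber.eq_one (ρ := {p}) ?_ ?_)
      · exact hU.of_dvd (relIndex_dvd_of_le_left _ le_sup_right)
      · exact hQU'.of_dvd (relIndex_dvd_of_le_left _ le_sup_left)
    refine ⟨k, hk, ?_⟩
    calc MulAut.conj k • U ≤ MulAut.conj k • (Q ⊔ D) := pointwise_smul_le_pointwise_smul_iff.2 hUQ
      _ = MulAut.conj k • Q ⊔ MulAut.conj k • D := smul_sup _ _ _
      _ ≤ P ⊔ D := sup_le_sup hle (conj_smul_eq (hD hk)).le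

end Hall

/-! ### Existence and dominance of Hall subgroups for each block. -/

section HallExistence

variable {π : Set Nat.Primes} {G : Type u} [Group G] [Finite G]

omit [Finite G] in
lemma relIndex_conj_smul {A K : Subgroup G} {k : G} (hk : k ∈ K) :
    (MulAut.conj k • A).relIndex K = A.relIndex K := by
  conv_lhs => rw [← conj_smul_eq (le_normalizer hk)]
  exact relIndex_pointwise_smul _ _ _

/-- Induction on `|K : D|` through a chief factor `E / D`. It is either a `π`-group, absorbed by the
Hall subgroup of `K / E`, or an abelian `p`-group with `p ∉ π`, split off by Schur–Zassenhaus. -/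
lemma HasBlockFactors.hallDominated_self (hG : HasBlockFactors π G) {K : Subgroup G} :
    ∀ {D : Subgroup G}, D ≤ K → K ≤ normalizer (D : Set G) → HallDominated π D K := by
  suffices h : ∀ n, ∀ D : Subgroup G, D.relIndex K = n → D ≤ K → K ≤ normalizer (D : Set G) →
      HallDominated π D K from fun {D} => h _ D rfl
  intro n
  induction n using Nat.strong_induction_on with
  | _ n ih =>
  intro D hn hDK hD
  obtain rfl | hlt := hDK.eq_or_lt
  · refine ⟨D, ⟨le_rfl, le_rfl, ?_, ?_⟩, fun U _ hU _ => ⟨1, one_mem _, by simpa using hU⟩⟩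
    · rw [relIndex_self]; exact isPiNumber_one
    · rw [relIndex_self]; exact isPiNumber_one
  obtain ⟨E, -, ⟨hDE, hEK, hE⟩, hmin⟩ := Finite.exists_le_minimal
    (p := fun E : Subgroup G => D < E ∧ E ≤ K ∧ K ≤ normalizer (E : Set G)) (a := K)
    ⟨hlt, le_rfl, le_normalizer⟩
  have hmin' : ∀ A, D ≤ A → A < E → K ≤ normalizer (A : Set G) → A = D := by
    intro A hDA hAE hA
    by_contra h
    exact hAE.not_ge (hmin ⟨lt_of_le_of_ne hDA (Ne.symm h), hAE.le.trans hEK, hA⟩ hAE.le)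
  have hidx : E.relIndex K < n := by
    have h1 := relIndex_mul_relIndex D E K hDE.le hEK
    have h2 : 1 < D.relIndex E := by
      have h3 := relIndex_ne_zero' D E
      have h4 : D.relIndex E ≠ 1 := fun h => hDE.not_ge (relIndex_eq_one.1 h)
      omega
    have h3 := Nat.pos_of_ne_zero (relIndex_ne_zero' E K)
    rw [← hn, ← h1]
    exact (Nat.lt_mul_iff_one_lt_left h3).2 h2
  obtain ⟨H, hH, hdom⟩ := ih _ hidx E rfl hEK hE
  obtain ⟨M, hDM, hME, hM, hidx'⟩ := hG.exists_normal_between hDE (hEK.trans hD)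
  -- A `K`-invariant subgroup of `ρ`-index inside `M` must be `D`, since `E / D` is a chief factor.
  have hblock : ∀ ρ, IsPiNumber ρ (M.relIndex E) → IsPiNumber ρ (D.relIndex E) := by
    intro ρ hρ
    obtain ⟨E', h1, h2, h3, h4⟩ := exists_invariant_le hDM hME.le hM hρ hD hE
    rwa [hmin' E' h1 (h2.trans_lt hME) h3] at h4
  have hdom' : ∀ U, D ≤ U → U ≤ K → IsPiNumber π (D.relIndex U) →
      ∃ k ∈ K, MulAut.conj k • U ≤ H := by
    intro U hDU hUK hU
    obtain ⟨k, hk, hle⟩ := hdom (U ⊔ E) le_sup_right (sup_le hUK hEK) (by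
      rw [relIndex_sup_of_le_normalizer (hUK.trans hE)]
      exact hU.of_dvd (relIndex_dvd_of_le_left _ hDE.le))
    exact ⟨k, hk, (pointwise_smul_le_pointwise_smul_iff.2 le_sup_left).trans hle⟩
  obtain hπ | ⟨p, hp, hMp⟩ := hidx'
  · refine ⟨H, ⟨hDE.le.trans hH.le, hH.le', ?_, hH.isPiNumber_compl⟩, hdom'⟩
    rw [← relIndex_mul_relIndex D E H hDE.le hH.le]
    exact (hblock π hπ).mul hH.isPiNumber
  · have hDp : IsPiNumber {p} (D.relIndex E) := hblock _ (hMp ▸ isPiNumber_prime)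
    have hcomm : ⁅E, E⁆ ≤ D := by
      have h1 : ⁅E, E⁆ ≤ M := by
        have hn : (M.subgroupOf E).Normal := normal_subgroupOf_of_le_normalizer hM
        have hcard : Nat.card (E ⧸ M.subgroupOf E) = p := by rw [← index_eq_card]; exact hMp
        have := Fact.mk p.2
        have hcyc : IsCyclic (E ⧸ M.subgroupOf E) := isCyclic_of_prime_card hcard
        rw [commutator_le]
        intro a ha b hb
        have h2 : (⟨a, ha⟩ * ⟨b, hb⟩ * ⟨a, ha⟩⁻¹ * ⟨b, hb⟩⁻¹ : E) ∈ M.subgroupOf E := by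
          rw [← QuotientGroup.eq_one_iff, ← QuotientGroup.mk'_apply, map_mul, map_mul, map_mul,
            map_inv, map_inv, mul_inv_eq_one, mul_inv_eq_iff_eq_mul]
          exact hcyc.isMulCommutative.is_comm.comm _ _
        exact h2
      have h3 : ⁅E, E⁆ ⊔ D = D := by
        refine hmin' _ le_sup_right ((sup_le h1 hDM).trans_lt hME) (le_normalizer_sup ?_ hD)
        intro k hk
        rw [mem_normalizer_iff_map_conj_eq, map_commutator,
          mem_normalizer_iff_map_conj_eq.1 (hE hk)]
      exact sup_eq_right.1 h3
    have hcop : Nat.Coprime (D.relIndex E) (E.relIndex H) :=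
      hDp.coprime hH.isPiNumber (Set.disjoint_singleton_left.2 hp)
    obtain ⟨C, hDC, hCH, hCE, hCE', hCdom⟩ := exists_relative_complement_dominating hDE.le hH.le
      (hH.le'.trans hD) (hH.le'.trans hE) hcomm hcop
    refine ⟨C, ⟨hDC, hCH.trans hH.le', ?_, ?_⟩, fun U hDU hUK hU => ?_⟩
    · rw [← hCE', inf_comm, inf_relIndex_right, ← relIndex_sup_of_le_normalizer
        (hCH.trans (hH.le'.trans hE)), hCE]
      exact hH.isPiNumber
    · rw [← relIndex_mul_relIndex C H K hCH hH.le']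
      refine IsPiNumber.mul ?_ hH.isPiNumber_compl
      rw [← hCE, relIndex_sup_of_le_normalizer' (hCH.trans (hH.le'.trans hE)),
        ← inf_relIndex_right, hCE']
      exact hDp.mono (Set.singleton_subset_iff.2 hp)
    · obtain ⟨k, hk, hle⟩ := hdom' U hDU hUK hU
      have hDk := le_conj_smul hDU (hD hk)
      obtain ⟨e, he, hle'⟩ := hCdom _ hDk hle (by
        refine (eq_of_le_of_relIndex_eq_one (le_inf hDk hDE.le) ?_).symm
        refine IsPiNumber.eq_one (ρ := {p}) (hDp.of_dvd ?_) (IsPiNumber.mono (hU.of_dvd ?_) ?_)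
        · exact ⟨_, (relIndex_mul_relIndex D _ E (le_inf hDk hDE.le) inf_le_right).symm⟩
        · rw [← relIndex_pointwise_smul (MulAut.conj k) D U, conj_smul_eq (hD hk)]
          exact ⟨_, (relIndex_mul_relIndex D _ _ (le_inf hDk hDE.le) inf_le_left).symm⟩
        · exact Set.subset_compl_singleton_iff.2 hp)
      exact ⟨e * k, K.mul_mem (hEK he) hk, by rwa [← conj_smul_conj_smul]⟩

/-- Relative Hall `ρ`-subgroups exist and dominate for `ρ = π` and for `ρ = {p}`, `p ∉ π`. -/
theorem HasBlockFactors.hallDominated (hG : HasBlockFactors π G) {ρ : Set Nat.Primes}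
    (hρ : ρ ∈ blocks π) {D K : Subgroup G} (hDK : D ≤ K) (hD : K ≤ normalizer (D : Set G)) :
    HallDominated ρ D K := by
  obtain rfl | ⟨p, -, rfl⟩ := hρ
  · exact hG.hallDominated_self hDK hD
  · exact hallDominated_singleton p hDK hD

-- As `|K : X|` is a `ρ'`-number, a Hall subgroup of `X / D` is conjugate to the dominating Hall
-- subgroup of `K / D`. Thus `X` itself absorbs all `ρ`-subgroups up to conjugacy.
omit [Finite G] in
lemma HallDominated.exists_conj_le {ρ : Set Nat.Primes} {D K X U : Subgroup G}
    (hK : HallDominated ρ D K) (hX : HallDominated ρ D X) (hD : K ≤ normalizer (D : Set G))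
    (hXK : X ≤ K) (hidx : IsPiNumber ρᶜ (X.relIndex K)) (hDU : D ≤ U) (hUK : U ≤ K)
    (hU : IsPiNumber ρ (D.relIndex U)) : ∃ k ∈ K, MulAut.conj k • U ≤ X := by
  obtain ⟨H, hH, hdom⟩ := hK
  obtain ⟨H', hH', -⟩ := hX
  obtain ⟨k, hk, hle⟩ := hdom H' hH'.le (hH'.le'.trans hXK) hH'.isPiNumber
  obtain ⟨l, hl, hle'⟩ := hdom U hDU hUK hU
  have hDk := le_conj_smul hH'.le (hD hk)
  have heq : MulAut.conj k • H' = H := by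
    refine eq_of_le_of_relIndex_eq_one hle (IsPiNumber.eq_one (ρ := ρ) ?_ ?_)
    · exact hH.isPiNumber.of_dvd ⟨_, by rw [mul_comm]; exact (relIndex_mul_relIndex _ _ _ hDk hle).symm⟩
    · have h1 : IsPiNumber ρᶜ (H'.relIndex K) := by
        rw [← relIndex_mul_relIndex H' X K hH'.le' hXK]
        exact hH'.isPiNumber_compl.mul hidx
      rw [← relIndex_conj_smul hk] at h1
      exact h1.of_dvd ⟨_, (relIndex_mul_relIndex _ _ _ hle hH.le').symm⟩
  refine ⟨k⁻¹ * l, K.mul_mem (K.inv_mem hk) hl, ?_⟩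
  rw [← conj_smul_conj_smul]
  calc _ ≤ MulAut.conj k⁻¹ • H := pointwise_smul_le_pointwise_smul_iff.2 hle'
    _ = H' := by rw [← heq, conj_inv_smul_conj_smul]
    _ ≤ X := hH'.le'

end HallExistence

/-! ### Fitting sets and their maximal members. -/

section FittingSets

variable {π : Set Nat.Primes} {G : Type u} [Group G] {Fm : Subgroup G → Prop}

/-- `V` is maximal among the subgroups of `K` that lie in the set `Fm`. -/
def IsMaximalIn (Fm : Subgroup G → Prop) (K V : Subgroup G) : Prop :=
  Maximal (fun U : Subgroup G => U ≤ K ∧ Fm U) V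

/-- A Fitting set of subgroups with unique maximal members above a normal subgroup whose index is
a `ρ`-number, for each block `ρ` of `π`. -/
structure IsFittingSet (π : Set Nat.Primes) (Fm : Subgroup G → Prop) : Prop where
  bot : Fm ⊥
  conj : ∀ (g : G) {U : Subgroup G}, Fm U → Fm (MulAut.conj g • U)
  of_normal : ∀ {U N : Subgroup G}, Fm U → N ≤ U → U ≤ normalizer (N : Set G) → Fm N
  sup : ∀ {M N : Subgroup G}, Fm M → Fm N → M ≤ normalizer (N : Set G) →
    N ≤ normalizer (M : Set G) → Fm (M ⊔ N)
  unique : ∀ {ρ : Set Nat.Primes}, ρ ∈ blocks π → ∀ {D H U V : Subgroup G},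
    H ≤ normalizer (D : Set G) → D ≤ U → D ≤ V → IsPiNumber ρ (D.relIndex H) →
    IsMaximalIn Fm H U → IsMaximalIn Fm H V → U = V

lemma IsMaximalIn.le {K V : Subgroup G} (h : IsMaximalIn Fm K V) : V ≤ K := h.1.1

lemma IsMaximalIn.mem {K V : Subgroup G} (h : IsMaximalIn Fm K V) : Fm V := h.1.2

lemma IsMaximalIn.of_le {K H V : Subgroup G} (h : IsMaximalIn Fm K V) (hV : V ≤ H) (hH : H ≤ K) :
    IsMaximalIn Fm H V :=
  ⟨⟨hV, h.mem⟩, fun _ hU hVU => h.2 ⟨hU.1.trans hH, hU.2⟩ hVU⟩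

lemma IsMaximalIn.eq_of_le {K V U : Subgroup G} (h : IsMaximalIn Fm K V) (hUK : U ≤ K) (hU : Fm U)
    (hVU : V ≤ U) : V = U := le_antisymm hVU (h.2 ⟨hUK, hU⟩ hVU)

lemma exists_isMaximalIn [Finite G] {K U : Subgroup G} (hU : U ≤ K) (hF : Fm U) :
    ∃ V, U ≤ V ∧ IsMaximalIn Fm K V := Finite.exists_le_maximal (p := fun U => U ≤ K ∧ Fm U) ⟨hU, hF⟩

namespace IsFittingSet

lemma conj_isMaximalIn (hF : IsFittingSet π Fm) (g : G) {K V : Subgroup G}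
    (h : IsMaximalIn Fm K V) : IsMaximalIn Fm (MulAut.conj g • K) (MulAut.conj g • V) := by
  refine ⟨⟨pointwise_smul_le_pointwise_smul_iff.2 h.le, hF.conj g h.mem⟩, ?_⟩
  rintro U ⟨hU, hUF⟩ hVU
  have h1 : MulAut.conj g⁻¹ • U ≤ V := by
    refine h.2 ⟨?_, hF.conj _ hUF⟩ ?_
    · rw [← conj_inv_smul_conj_smul g K]
      exact pointwise_smul_le_pointwise_smul_iff.2 hU
    · rw [← conj_inv_smul_conj_smul g V]
      exact pointwise_smul_le_pointwise_smul_iff.2 hVU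
  rw [← conj_smul_conj_inv_smul g U]
  exact pointwise_smul_le_pointwise_smul_iff.2 h1

lemma conj_isMaximalIn_self (hF : IsFittingSet π Fm) {g : G} {K V : Subgroup G}
    (h : IsMaximalIn Fm K V) (hg : g ∈ normalizer (K : Set G)) :
    IsMaximalIn Fm K (MulAut.conj g • V) := by
  have := hF.conj_isMaximalIn g h
  rwa [conj_smul_eq hg] at this

/-- `V ⊓ N` is normal in `V`, hence a member of `N` that contains the maximal member `W`. -/
lemma inf_eq (hF : IsFittingSet π Fm) {N V W : Subgroup G} (hW : IsMaximalIn Fm N W) (hV : Fm V)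
    (hN : V ≤ normalizer (N : Set G)) (hWV : W ≤ V) : V ⊓ N = W :=
  (hW.eq_of_le inf_le_right (hF.of_normal hV inf_le_left (le_normalizer_inf le_normalizer hN))
    (le_inf hWV hW.le)).symm

variable [Finite G]

/-- Maximal members of `K` above a given maximal member of a normal subgroup `N` of `ρ`-index are
conjugate under `N`. -/
theorem exists_conj_of_normal (hF : IsFittingSet π Fm) (hG : HasBlockFactors π G)
    {ρ : Set Nat.Primes} (hρ : ρ ∈ blocks π) {N K W V V' : Subgroup G}
    (hN : K ≤ normalizer (N : Set G)) (hidx : IsPiNumber ρ (N.relIndex K))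
    (hNK : N ≤ K) (hW : IsMaximalIn Fm N W) (hV : IsMaximalIn Fm K V) (hV' : IsMaximalIn Fm K V')
    (hWV : W ≤ V) (hWV' : W ≤ V') : ∃ n ∈ N, MulAut.conj n • V = V' := by
  -- Since `V ⊓ N = W`, both `V` and `V'` normalize `W` and are `ρ`-groups modulo `W`. They can
  -- therefore be moved into one Hall subgroup `H / W` of `T / W`, where `unique` identifies them.
  set T := K ⊓ normalizer (W : Set G) with hT
  have hTW : T ≤ normalizer (W : Set G) := inf_le_right
  have hWT : W ≤ T := le_inf (hW.le.trans hNK) le_normalizer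
  obtain ⟨H, hH, hdom⟩ := hG.hallDominated hρ hWT hTW
  have hHK : H ≤ K := hH.le'.trans inf_le_left
  have hTHN : T ≤ H ⊔ N := by
    refine relIndex_eq_one.1 (IsPiNumber.eq_one (ρ := ρ) ?_ ?_)
    · exact (hidx.of_dvd (relIndex_dvd_of_le_normalizer inf_le_left hN)).of_dvd
        (relIndex_dvd_of_le_left _ le_sup_right)
    · exact hH.isPiNumber_compl.of_dvd (relIndex_dvd_of_le_left _ le_sup_left)
  have key : ∀ V, IsMaximalIn Fm K V → W ≤ V →
      ∃ n ∈ N, MulAut.conj n • V ≤ H ∧ W ≤ MulAut.conj n • V := by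
    intro V hV hWV
    have hVN := hF.inf_eq hW hV.mem (hV.le.trans hN) hWV
    have hVW : V ≤ normalizer (W : Set G) := by
      rw [← hVN]; exact le_normalizer_inf le_normalizer (hV.le.trans hN)
    obtain ⟨t, ht, hle⟩ := hdom V hWV (le_inf hV.le hVW) (by
      rw [← hVN, inf_relIndex_left]
      exact hidx.of_dvd (relIndex_dvd_of_le_normalizer hV.le hN))
    -- Because `T ≤ HN`, the conjugating element factors as `h * n`; the factor in `H` can be
    -- dropped.
    obtain ⟨h, hh, n, hn, rfl⟩ := (mem_sup_of_le_normalizer (hHK.trans hN)).1 (hTHN ht)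
    refine ⟨n, hn, ?_, ?_⟩
    · have h1 := conj_smul_le hle (le_normalizer (H.inv_mem hh))
      rwa [conj_smul_conj_smul, inv_mul_cancel_left] at h1
    · refine le_conj_smul hWV (hTW ?_)
      have := T.mul_mem (T.inv_mem (hH.le' hh)) ht
      rwa [inv_mul_cancel_left] at this
  obtain ⟨n, hn, h1, h2⟩ := key V hV hWV
  obtain ⟨n', hn', h1', h2'⟩ := key V' hV' hWV'
  have heq := hF.unique hρ (hH.le'.trans hTW) h2 h2' hH.isPiNumber
    ((hF.conj_isMaximalIn_self hV (le_normalizer (hNK hn))).of_le h1 hHK)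
    ((hF.conj_isMaximalIn_self hV' (le_normalizer (hNK hn'))).of_le h1' hHK)
  refine ⟨n'⁻¹ * n, N.mul_mem (N.inv_mem hn') hn, ?_⟩
  rw [← conj_smul_conj_smul, heq, conj_inv_smul_conj_smul]

/-- One descent step, from `E` to `E'`, when `E / E'` is a `σ'`-group and `Y / D` a `σ`-group. A
Frattini argument shows that `X = N_{YE}(W)` covers `YE / E`, so `XE'` has `σ'`-index in `YE` and
contains some `Y^e E'`. As `XE'` normalizes `WE'`, the commutator falls into `WE' ⊓ E = E'`. -/
lemma exists_commutator_conj_le_of_compl (hF : IsFittingSet π Fm) (hG : HasBlockFactors π G)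
    {σ τ : Set Nat.Primes} (hσ : σ ∈ blocks π) (hτ : τ ∈ blocks π)
    {N D E E' W Y T : Subgroup G} (hD : T ≤ normalizer (D : Set G)) (hE : T ≤ normalizer (E : Set G))
    (hE' : T ≤ normalizer (E' : Set G)) (hN : T ≤ normalizer (N : Set G))
    (hWT : W ≤ T) (hYT : Y ≤ T) (hET : E ≤ T) (hEN : E ≤ N) (hDE' : D ≤ E') (hEE' : E' ≤ E)
    (hW : IsMaximalIn Fm N W) (hDm : IsMaximalIn Fm E D) (hDW : D ≤ W)
    (hWE : W ⊓ E = D) (hWτ : IsPiNumber τ (D.relIndex W)) (hYσ : IsPiNumber σ (D.relIndex Y))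
    (hEσ : IsPiNumber σᶜ (E'.relIndex E)) (hWY : ⁅W, Y⁆ ≤ E) :
    ∃ e ∈ E, ⁅W, MulAut.conj e • Y⁆ ≤ E' := by
  have hWEN : W ⊔ E ≤ N := sup_le hW.le hEN
  have hYE : Y ⊔ E ≤ T := sup_le hYT hET
  -- Both `W` and its conjugate by `y` are maximal members of `WE` above the maximal member `D` of
  -- `E`.
  have hconj : ∀ y ∈ Y, ∃ e ∈ E, MulAut.conj e • W = MulAut.conj y • W := by
    intro y hy
    have hle : MulAut.conj y • W ≤ W ⊔ E := by
      intro x hx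
      rw [mem_conj_smul] at hx
      have h1 := hWY (commutator_mem_commutator hx hy)
      have h2 : x = (y⁻¹ * x * y) * ((y⁻¹ * x * y)⁻¹ *
          (⁅y⁻¹ * x * y, y⁆)⁻¹ * (y⁻¹ * x * y)⁻¹⁻¹) := by
        rw [commutatorElement_def]; group
      rw [h2]
      exact mul_mem (mem_sup_left hx) (mem_sup_right
        ((mem_normalizer_iff.1 (hE (hWT (W.inv_mem hx))) _).1 (E.inv_mem h1)))
    refine hF.exists_conj_of_normal hG hτ (N := E) (K := W ⊔ E)
      (sup_le (hWT.trans hE) le_normalizer) ?_ le_sup_right hDm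
      (hW.of_le le_sup_left hWEN)
      ((hF.conj_isMaximalIn_self hW (hN (hYT hy))).of_le hle hWEN) hDW
      (le_conj_smul hDW (hD (hYT hy)))
    rw [relIndex_sup_of_le_normalizer (hWT.trans hE)]
    exact hWτ.of_dvd (relIndex_dvd_of_le_left _ (hDE'.trans hEE'))
  set X := (Y ⊔ E) ⊓ normalizer (W : Set G) with hX
  have hXE' : X ⊔ E' ≤ Y ⊔ E := sup_le inf_le_left (hEE'.trans le_sup_right)
  have hYX : Y ⊔ E ≤ (X ⊔ E') ⊔ E := by
    refine sup_le (fun y hy => ?_) le_sup_right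
    obtain ⟨e, he, h⟩ := hconj y hy
    have h1 : e⁻¹ * y ∈ X := by
      refine ⟨mul_mem (mem_sup_right (E.inv_mem he)) (mem_sup_left hy), ?_⟩
      refine mem_normalizer_iff_conj_smul.2 ?_
      rw [← conj_smul_conj_smul, ← h, conj_inv_smul_conj_smul]
    have h2 := ((X ⊔ E') ⊔ E).mul_mem (mem_sup_right he) (mem_sup_left (mem_sup_left h1))
    rwa [mul_inv_cancel_left] at h2
  have hYXeq : Y ⊔ E = (X ⊔ E') ⊔ E := le_antisymm hYX (sup_le hXE' le_sup_right)
  have hXidx : IsPiNumber σᶜ ((X ⊔ E').relIndex (Y ⊔ E)) := by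
    rw [hYXeq, relIndex_sup_of_le_normalizer' (hXE'.trans (hYE.trans hE))]
    exact hEσ.of_dvd (relIndex_dvd_of_le_left _ le_sup_right)
  obtain ⟨k, hk, hle⟩ := HallDominated.exists_conj_le (U := Y ⊔ E')
    (hG.hallDominated hσ (D := E') (K := Y ⊔ E) (hEE'.trans le_sup_right) (hYE.trans hE'))
    (hG.hallDominated hσ (D := E') (K := X ⊔ E') le_sup_right (hXE'.trans (hYE.trans hE')))
    (hYE.trans hE') hXE' hXidx le_sup_right (sup_le_sup_left hEE' Y) (by
      rw [relIndex_sup_of_le_normalizer (hYT.trans hE')]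
      exact hYσ.of_dvd (relIndex_dvd_of_le_left _ hDE'))
  obtain ⟨e, he, y, hy, rfl⟩ := (mem_sup_of_le_normalizer' (hYT.trans hE)).1 hk
  have hYe : MulAut.conj e • Y ≤ X ⊔ E' := by
    refine le_trans ?_ ((pointwise_smul_le_pointwise_smul_iff.2 le_sup_left).trans hle)
    rw [← conj_smul_conj_smul, conj_smul_eq (le_normalizer hy)]
  have hXn : X ⊔ E' ≤ normalizer ((W ⊔ E' : Subgroup G) : Set G) :=
    sup_le (le_normalizer_sup inf_le_right (inf_le_left.trans (hYE.trans hE')))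
      (le_sup_right.trans le_normalizer)
  refine ⟨e, he, ?_⟩
  have hmod : (W ⊔ E') ⊓ E = E' := by
    rw [sup_inf_of_le (hWT.trans hE') hEE', hWE, sup_eq_right.2 hDE']
  rw [commutator_le, ← hmod]
  intro w hw z hz
  refine ⟨?_, ?_⟩
  · have h1 := (mem_normalizer_iff.1 (hXn (hYe hz)) w⁻¹).1 (mem_sup_left (W.inv_mem hw))
    have h2 := (W ⊔ E').mul_mem (mem_sup_left hw) h1
    rw [commutatorElement_def]
    simpa [mul_assoc] using h2
  · rw [mem_conj_smul] at hz
    obtain ⟨v, hv⟩ : ∃ v, v = e⁻¹ * z * e := ⟨_, rfl⟩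
    rw [← hv] at hz
    have hzv : z = e * v * e⁻¹ := by rw [hv]; group
    have hvE := hE (hYT hz)
    have h1 : v⁻¹ * e * v * e⁻¹ ∈ E :=
      E.mul_mem ((mem_normalizer_iff''.1 hvE e).1 he) (E.inv_mem he)
    obtain ⟨f, hf⟩ : ∃ f, f = v⁻¹ * e * v * e⁻¹ := ⟨_, rfl⟩
    rw [← hf] at h1
    have hzf : z = v * f := by rw [hf, hzv]; group
    have h2 : ⁅w, z⁆ = ⁅w, v⁆ * (v * (w * f * w⁻¹ * f⁻¹) * v⁻¹) := by
      rw [commutatorElement_def, commutatorElement_def, hzf]; group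
    rw [h2]
    refine E.mul_mem (hWY (commutator_mem_commutator hw hz)) ?_
    refine (mem_normalizer_iff.1 hvE _).1 (E.mul_mem ?_ (E.inv_mem h1))
    exact (mem_normalizer_iff.1 (hE (hWT hw)) _).1 h1

/-- Descent along a `T`-invariant chain from `E` to `D` whose factors each belong to one block `ρ`.
As `σ ≠ τ`, `ρ` differs from one of them, so the descent step applies with `W` and `Y` in one order
or the other. -/
lemma exists_commutator_conj_le_aux (hF : IsFittingSet π Fm) (hG : HasBlockFactors π G)
    {σ τ : Set Nat.Primes} (hσ : σ ∈ blocks π) (hτ : τ ∈ blocks π) (hστ : σ ≠ τ)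
    {N M D T : Subgroup G} (hD : T ≤ normalizer (D : Set G))
    (hN : T ≤ normalizer (N : Set G)) (hM : T ≤ normalizer (M : Set G))
    (hDm : IsMaximalIn Fm (N ⊓ M) D) (n : ℕ) :
    ∀ E W Y : Subgroup G, Nat.card E = n → D ≤ E → E ≤ N ⊓ M → E ≤ T →
      T ≤ normalizer (E : Set G) → W ≤ T → Y ≤ T → IsMaximalIn Fm N W → IsMaximalIn Fm M Y →
      W ⊓ (N ⊓ M) = D → Y ⊓ (N ⊓ M) = D → IsPiNumber τ (D.relIndex W) →
      IsPiNumber σ (D.relIndex Y) → ⁅W, Y⁆ ≤ E → ∃ e ∈ E, ⁅W, MulAut.conj e • Y⁆ ≤ D := by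
  induction n using Nat.strong_induction_on with
  | _ n ih =>
  intro E W Y hn hDE hEL hET hE hWT hYT hW hY hWL hYL hWτ hYσ hWY
  obtain rfl | hlt := hDE.eq_or_lt
  · exact ⟨1, one_mem _, by simpa using hWY⟩
  have hDW : D ≤ W := hWL ▸ inf_le_left
  have hDY : D ≤ Y := hYL ▸ inf_le_left
  have hWE : W ⊓ E = D :=
    le_antisymm (hWL ▸ inf_le_inf_left W hEL) (le_inf hDW hDE)
  have hYE : Y ⊓ E = D :=
    le_antisymm (hYL ▸ inf_le_inf_left Y hEL) (le_inf hDY hDE)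
  obtain ⟨A, hDA, hAE, hA, hidx⟩ := hG.exists_normal_between hlt (hET.trans hD)
  obtain ⟨ρ, hρ, hidx⟩ := exists_block hidx
  obtain ⟨E', hDE', hE'A, hE', hE'ρ⟩ := exists_invariant_le hDA hAE.le hA hidx hD hE
  have hE'E : E' < E := hE'A.trans_lt hAE
  obtain ⟨e, he, hWYe⟩ : ∃ e ∈ E, ⁅W, MulAut.conj e • Y⁆ ≤ E' := by
    by_cases h : ρ = σ
    · have hρτ : ρ ≠ τ := fun h' => hστ (h ▸ h')
      obtain ⟨e, he, h1⟩ := hF.exists_commutator_conj_le_of_compl hG hτ hσ hD hE hE' hM hYT hWT hET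
        (hEL.trans inf_le_right) hDE' hE'E.le hY (hDm.of_le hDE hEL) hDY hYE hYσ hWτ
        (hE'ρ.mono (disjoint_of_mem_blocks hρ hτ hρτ).subset_compl_right)
        (by rwa [commutator_comm])
      refine ⟨e⁻¹, E.inv_mem he, ?_⟩
      rw [commutator_le] at h1 ⊢
      intro w hw z hz
      rw [mem_conj_smul, inv_inv] at hz
      have h2 := h1 _ hz _ (conj_mem_conj_smul.2 hw)
      have h3 : ⁅e * z * e⁻¹, e * w * e⁻¹⁆ = e * ⁅z, w⁆ * e⁻¹ := by
        simp only [commutatorElement_def]; group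
      rw [h3, ← mem_normalizer_iff.1 (hE' (hET he))] at h2
      rw [← commutatorElement_inv]
      exact E'.inv_mem h2
    · exact hF.exists_commutator_conj_le_of_compl hG hσ hτ hD hE hE' hN hWT hYT hET
        (hEL.trans inf_le_left) hDE' hE'E.le hW (hDm.of_le hDE hEL) hDW hWE hWτ hYσ
        (hE'ρ.mono (disjoint_of_mem_blocks hρ hσ h).subset_compl_right) hWY
  have hDe := conj_smul_eq (hD (hET he))
  obtain ⟨e', he', h⟩ := ih _ (hn ▸ card_lt_card hE'E) E' W (MulAut.conj e • Y) rfl hDE'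
    (hE'E.le.trans hEL) (hE'E.le.trans hET) hE' hWT (conj_smul_le hYT (le_normalizer (hET he))) hW
    (hF.conj_isMaximalIn_self hY (hM (hET he))) hWL (by
      have hL := conj_smul_eq (le_normalizer (hEL he))
      conv_lhs => enter [2]; rw [← hL]
      rw [← smul_inf, hYL, hDe]) hWτ (by
      conv => enter [2, 1]; rw [← hDe]
      rwa [relIndex_pointwise_smul]) hWYe
  exact ⟨e' * e, E.mul_mem (hE'E.le he') he, by rwa [← conj_smul_conj_smul]⟩

/-- Maximal members `W` of `N` and `Y` of `M` above a common maximal member `D` of `N ⊓ M` can be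
chosen to commute modulo `D`, if the indices of `N ⊓ M` involve different blocks. -/
theorem exists_commutator_conj_le (hF : IsFittingSet π Fm) (hG : HasBlockFactors π G)
    {σ τ : Set Nat.Primes} (hσ : σ ∈ blocks π) (hτ : τ ∈ blocks π) (hστ : σ ≠ τ)
    {K N M D W Y : Subgroup G} (hNK : N ≤ K) (hMK : M ≤ K) (hN : K ≤ normalizer (N : Set G))
    (hM : K ≤ normalizer (M : Set G)) (hDm : IsMaximalIn Fm (N ⊓ M) D) (hW : IsMaximalIn Fm N W)
    (hY : IsMaximalIn Fm M Y) (hDW : D ≤ W) (hDY : D ≤ Y)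
    (hτ' : IsPiNumber τ ((N ⊓ M).relIndex N)) (hσ' : IsPiNumber σ ((N ⊓ M).relIndex M)) :
    ∃ e ∈ (N ⊓ M) ⊓ normalizer (D : Set G), ⁅W, MulAut.conj e • Y⁆ ≤ D := by
  have hL : K ≤ normalizer ((N ⊓ M : Subgroup G) : Set G) := le_normalizer_inf hN hM
  have hWK := hW.le.trans hNK
  have hYK := hY.le.trans hMK
  have hWL := hF.inf_eq hDm hW.mem (hWK.trans hL) hDW
  have hYL := hF.inf_eq hDm hY.mem (hYK.trans hL) hDY
  set T := K ⊓ normalizer (D : Set G) with hT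
  have hTK : T ≤ K := inf_le_left
  have hWT : W ≤ T := le_inf hWK (by
    conv => enter [2, 1, 1]; rw [← hWL]
    exact le_normalizer_inf le_normalizer (hWK.trans hL))
  have hYT : Y ≤ T := le_inf hYK (by
    conv => enter [2, 1, 1]; rw [← hYL]
    exact le_normalizer_inf le_normalizer (hYK.trans hL))
  have hE : (N ⊓ M) ⊓ normalizer (D : Set G) = (N ⊓ M) ⊓ T := by
    rw [hT, ← inf_assoc, inf_eq_left.2 (inf_le_left.trans hNK : N ⊓ M ≤ K)]
  rw [hE]
  refine hF.exists_commutator_conj_le_aux hG hσ hτ hστ inf_le_right (hTK.trans hN) (hTK.trans hM)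
    hDm _ _ W Y rfl (le_inf hDm.le (hDW.trans hWT)) inf_le_left inf_le_right
    (le_normalizer_inf (hTK.trans hL) le_normalizer) hWT hYT hW hY hWL hYL ?_ ?_ ?_
  · rw [← hWL, inf_relIndex_left]
    exact hτ'.of_dvd (relIndex_dvd_of_le_normalizer hW.le (hNK.trans hL))
  · rw [← hYL, inf_relIndex_left]
    exact hσ'.of_dvd (relIndex_dvd_of_le_normalizer hY.le (hMK.trans hL))
  · rw [commutator_le]
    intro w hw y hy
    have h1 : ⁅w, y⁆ = w * (y * w⁻¹ * y⁻¹) := by rw [commutatorElement_def]; group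
    have h2 : ⁅w, y⁆ = (w * y * w⁻¹) * y⁻¹ := commutatorElement_def w y
    refine ⟨⟨?_, ?_⟩, ?_⟩
    · rw [h1]
      exact N.mul_mem (hW.le hw)
        ((mem_normalizer_iff.1 (hN (hYK hy)) _).1 (N.inv_mem (hW.le hw)))
    · rw [h2]
      exact M.mul_mem ((mem_normalizer_iff.1 (hM (hWK hw)) _).1 (hY.le hy)) (M.inv_mem (hY.le hy))
    · rw [h2]
      exact T.mul_mem (T.mul_mem (T.mul_mem (hWT hw) (hYT hy)) (T.inv_mem (hWT hw)))
        (T.inv_mem (hYT hy))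

end IsFittingSet

end FittingSets

/-! ### Conjugacy and existence of injectors for a Fitting set. -/

section Injectors

variable {π : Set Nat.Primes} {G : Type u} [Group G] {Fm : Subgroup G → Prop}

/-- `S` is a subnormal subgroup of `K`. -/
inductive SubnormalIn (S : Subgroup G) : Subgroup G → Prop
  | refl : SubnormalIn S S
  | step {N K : Subgroup G} : N ≤ K → K ≤ normalizer (N : Set G) → SubnormalIn S N →
      SubnormalIn S K

lemma SubnormalIn.le {S K : Subgroup G} (h : SubnormalIn S K) : S ≤ K := by
  induction h with
  | refl => exact le_rfl
  | step h _ _ ih => exact ih.trans h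

lemma SubnormalIn.of_normal {H S K : Subgroup G} (h : SubnormalIn S K) (hH : H ≤ S)
    (hn : S ≤ normalizer (H : Set G)) : SubnormalIn H K := by
  induction h with
  | refl => exact .step hH hn .refl
  | step h1 h2 _ ih => exact .step h1 h2 ih

lemma SubnormalIn.conj {S K : Subgroup G} (h : SubnormalIn S K) (g : G) :
    SubnormalIn (MulAut.conj g • S) (MulAut.conj g • K) := by
  induction h with
  | refl => exact .refl
  | step h1 h2 _ ih =>
    refine .step (pointwise_smul_le_pointwise_smul_iff.2 h1) ?_ ih
    rw [normalizer_conj_smul]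
    exact pointwise_smul_le_pointwise_smul_iff.2 h2

lemma SubnormalIn.eq_or_exists {S K : Subgroup G} (h : SubnormalIn S K) :
    S = K ∨ ∃ M < K, K ≤ normalizer (M : Set G) ∧ SubnormalIn S M := by
  induction h with
  | refl => exact Or.inl rfl
  | @step N K h1 h2 h3 ih =>
    obtain rfl | hlt := h1.eq_or_lt
    · exact ih
    · exact Or.inr ⟨N, hlt, h2, h3⟩

/-- `V` is an injector of `K` for the set `Fm` of subgroups. -/
def IsInjectorIn (Fm : Subgroup G → Prop) (K V : Subgroup G) : Prop :=
  V ≤ K ∧ ∀ S, SubnormalIn S K → IsMaximalIn Fm S (V ⊓ S)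

namespace IsInjectorIn

lemma isMaximalIn {K V : Subgroup G} (h : IsInjectorIn Fm K V) : IsMaximalIn Fm K V := by
  have := h.2 K .refl
  rwa [inf_eq_left.2 h.1] at this

lemma inf {K V N : Subgroup G} (h : IsInjectorIn Fm K V) (hNK : N ≤ K)
    (hN : K ≤ normalizer (N : Set G)) : IsInjectorIn Fm N (V ⊓ N) := by
  refine ⟨inf_le_right, fun S hS => ?_⟩
  rw [inf_assoc, inf_eq_right.2 hS.le]
  exact h.2 S (.step hNK hN hS)

lemma conj (hF : IsFittingSet π Fm) {K V : Subgroup G} (h : IsInjectorIn Fm K V) (g : G) :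
    IsInjectorIn Fm (MulAut.conj g • K) (MulAut.conj g • V) := by
  refine ⟨pointwise_smul_le_pointwise_smul_iff.2 h.1, fun S hS => ?_⟩
  have h1 := hS.conj g⁻¹
  rw [conj_inv_smul_conj_smul] at h1
  have h2 := hF.conj_isMaximalIn g (h.2 _ h1)
  rwa [smul_inf, conj_smul_conj_inv_smul] at h2

lemma conj_self (hF : IsFittingSet π Fm) {K V : Subgroup G} (h : IsInjectorIn Fm K V) {g : G}
    (hg : g ∈ normalizer (K : Set G)) : IsInjectorIn Fm K (MulAut.conj g • V) := by
  have := h.conj hF g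
  rwa [conj_smul_eq hg] at this

end IsInjectorIn

namespace IsFittingSet

variable [Finite G]

/-- The traces on `N` are injectors of `N`. Once they are made equal by conjugation in `N`,
`exists_conj_of_normal` finishes. Conjugacy in `N` is a hypothesis so that the lemma also serves as
the induction step. -/
lemma exists_conj_of_normal_of_forall (hF : IsFittingSet π Fm) (hG : HasBlockFactors π G)
    {ρ : Set Nat.Primes} (hρ : ρ ∈ blocks π) {N K V V' : Subgroup G} (hNK : N ≤ K)
    (hN : K ≤ normalizer (N : Set G)) (hidx : IsPiNumber ρ (N.relIndex K))
    (hV : IsInjectorIn Fm K V) (hV' : IsInjectorIn Fm K V')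
    (h : ∀ W W', IsInjectorIn Fm N W → IsInjectorIn Fm N W' → ∃ n ∈ N, MulAut.conj n • W = W') :
    ∃ n ∈ N, MulAut.conj n • V = V' := by
  obtain ⟨n, hn, heq⟩ := h _ _ (hV.inf hNK hN) (hV'.inf hNK hN)
  have hle : V' ⊓ N ≤ MulAut.conj n • V := by
    rw [← heq]
    exact pointwise_smul_le_pointwise_smul_iff.2 inf_le_left
  obtain ⟨n', hn', h'⟩ := hF.exists_conj_of_normal hG hρ hN hidx hNK (hV'.inf hNK hN).isMaximalIn
    (hF.conj_isMaximalIn_self hV.isMaximalIn (le_normalizer (hNK hn))) hV'.isMaximalIn hle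
    inf_le_left
  exact ⟨n' * n, N.mul_mem hn' hn, by rw [← conj_smul_conj_smul, h']⟩

/-- Any two injectors are conjugate. -/
theorem exists_conj_eq (hF : IsFittingSet π Fm) (hG : HasBlockFactors π G) (K : Subgroup G) :
    ∀ V V', IsInjectorIn Fm K V → IsInjectorIn Fm K V' → ∃ k ∈ K, MulAut.conj k • V = V' := by
  induction K using WellFoundedLT.induction with
  | _ K ih =>
  intro V V' hV hV'
  by_cases hK : K = ⊥
  · subst hK
    refine ⟨1, one_mem _, ?_⟩
    rw [le_bot_iff.1 hV.1, le_bot_iff.1 hV'.1]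
    simp
  · obtain ⟨N, hNK, hN, hidx⟩ := hG K hK
    obtain ⟨ρ, hρ, hidx⟩ := exists_block hidx
    obtain ⟨n, hn, h⟩ := hF.exists_conj_of_normal_of_forall hG hρ hNK.le hN hidx hV hV' (ih N hNK)
    exact ⟨n, hNK.le hn, h⟩

/-- Any two injectors of `K` are conjugate under each normal subgroup of `ρ`-index. -/
theorem exists_conj_eq_of_normal (hF : IsFittingSet π Fm) (hG : HasBlockFactors π G)
    {ρ : Set Nat.Primes} (hρ : ρ ∈ blocks π) {N K V V' : Subgroup G} (hNK : N ≤ K)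
    (hN : K ≤ normalizer (N : Set G)) (hidx : IsPiNumber ρ (N.relIndex K))
    (hV : IsInjectorIn Fm K V) (hV' : IsInjectorIn Fm K V') :
    ∃ n ∈ N, MulAut.conj n • V = V' :=
  hF.exists_conj_of_normal_of_forall hG hρ hNK hN hidx hV hV' (hF.exists_conj_eq hG N)

/-- A maximal member of `K` above an injector of a normal subgroup of `ρ`-index is an injector. -/
theorem isInjectorIn_of_isMaximalIn (hF : IsFittingSet π Fm) (hG : HasBlockFactors π G)
    (K : Subgroup G) : ∀ {ρ : Set Nat.Primes}, ρ ∈ blocks π → ∀ {N W V : Subgroup G}, N ≤ K →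
      K ≤ normalizer (N : Set G) → IsPiNumber ρ (N.relIndex K) → IsInjectorIn Fm N W → W ≤ V →
      IsMaximalIn Fm K V → IsInjectorIn Fm K V := by
  induction K using WellFoundedLT.induction with
  | _ K ih =>
  intro ρ hρ N W V hNK hN hidx hW hWV hV
  refine ⟨hV.le, fun S hS => ?_⟩
  obtain rfl | ⟨A, hAK, hA, hSA⟩ := hS.eq_or_exists
  · rwa [inf_eq_left.2 hV.le]
  obtain ⟨M, hAM, hMK, hM, hMidx⟩ := hG.exists_normal_between hAK hA
  obtain ⟨τ, hτ, hMidx⟩ := exists_block hMidx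
  have hSM : SubnormalIn S M := .step hAM (hMK.le.trans hA) hSA
  suffices h : IsInjectorIn Fm M (V ⊓ M) by
    have := h.2 S hSM
    rwa [inf_assoc, inf_eq_right.2 hSM.le] at this
  have hLK : N ⊓ M ≤ K := inf_le_left.trans hNK
  have hL : K ≤ normalizer ((N ⊓ M : Subgroup G) : Set G) := le_normalizer_inf hN hM
  have hLM : IsPiNumber ρ ((N ⊓ M).relIndex M) := by
    rw [inf_relIndex_right]
    exact hidx.of_dvd (relIndex_dvd_of_le_normalizer hMK.le hN)
  have hLN : IsPiNumber τ ((N ⊓ M).relIndex N) := by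
    rw [inf_relIndex_left]
    exact hMidx.of_dvd (relIndex_dvd_of_le_normalizer hNK hM)
  have hD : IsInjectorIn Fm (N ⊓ M) (W ⊓ (N ⊓ M)) := hW.inf inf_le_left (hNK.trans hL)
  obtain ⟨Y, hDY, hY⟩ := exists_isMaximalIn (hD.1.trans inf_le_right) hD.isMaximalIn.mem
  have hYinj : IsInjectorIn Fm M Y :=
    ih M hMK hρ inf_le_right (hMK.le.trans hL) hLM hD hDY hY
  -- A maximal member `V'` above a conjugate of the injector `Y` of `M` meets `M` in that conjugate;
  -- if `V'` is conjugate to `V`, then `V ⊓ M` is an injector of `M`.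
  suffices h : ∃ V' l k, l ∈ K ∧ k ∈ K ∧ IsMaximalIn Fm K V' ∧ MulAut.conj l • Y ≤ V' ∧
      MulAut.conj k • V' = V by
    obtain ⟨V', l, k, hl, hk, hV', hYV', rfl⟩ := h
    have h1 : V' ⊓ M = MulAut.conj l • Y := hF.inf_eq
      (hF.conj_isMaximalIn_self hY (hM hl)) hV'.mem (hV'.le.trans hM) hYV'
    have h2 : MulAut.conj k • V' ⊓ M = MulAut.conj k • MulAut.conj l • Y := by
      conv_lhs => enter [2]; rw [← conj_smul_eq (hM hk)]
      rw [← smul_inf, h1]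
    rw [h2, conj_smul_conj_smul]
    exact hYinj.conj_self hF (hM (K.mul_mem hk hl))
  -- For equal blocks `N ⊓ M` itself has `ρ`-index in `K`, and any `V'` above `Y` will do. For
  -- different blocks `V'` is taken above the product of `W` and a conjugate of `Y`.
  by_cases h : ρ = τ
  · subst h
    obtain ⟨V', hYV', hV'⟩ := exists_isMaximalIn (hY.le.trans hMK.le) hY.mem
    obtain ⟨k, hk, h⟩ := hF.exists_conj_of_normal hG hρ hL
      (isPiNumber_relIndex_inf hN hidx hMidx) hLK hD.isMaximalIn hV' hV (hDY.trans hYV')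
      (inf_le_left.trans hWV)
    exact ⟨V', 1, k, one_mem _, hLK hk, hV', by simpa using hYV', h⟩
  · obtain ⟨l, ⟨hlL, hlD⟩, hcomm⟩ := hF.exists_commutator_conj_le hG hρ hτ h hNK hMK.le hN hM
      hD.isMaximalIn hW.isMaximalIn hY inf_le_left hDY hLN hLM
    have hlK : l ∈ K := hLK hlL
    rw [commutator_le] at hcomm
    have hDY' : W ⊓ (N ⊓ M) ≤ MulAut.conj l • Y := le_conj_smul hDY hlD
    have hle : W ⊔ MulAut.conj l • Y ≤ K :=
      sup_le (hW.1.trans hNK) (conj_smul_le (hY.le.trans hMK.le) (le_normalizer hlK))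
    have hmem : Fm (W ⊔ MulAut.conj l • Y) := by
      refine hF.sup hW.isMaximalIn.mem (hF.conj l hY.mem) (le_normalizer_iff.2 ?_)
        (le_normalizer_iff.2 ?_)
      · intro w hw y hy
        have h1 : w * y * w⁻¹ = ⁅w, y⁆ * y := by rw [commutatorElement_def]; group
        rw [h1]
        exact mul_mem (hDY' (hcomm w hw y hy)) hy
      · intro y hy w hw
        have h1 : y * w * y⁻¹ = ⁅w, y⁆⁻¹ * w := by rw [commutatorElement_def]; group
        rw [h1]
        exact W.mul_mem (W.inv_mem (hcomm w hw y hy).1) hw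
    obtain ⟨V', hZV', hV'⟩ := exists_isMaximalIn hle hmem
    obtain ⟨k, hk, h⟩ := hF.exists_conj_of_normal hG hρ hN hidx hNK hW.isMaximalIn hV' hV
      (le_sup_left.trans hZV') hWV
    exact ⟨V', l, k, hlK, hNK hk, hV', le_sup_right.trans hZV', h⟩

/-- Injectors exist. -/
theorem exists_isInjectorIn (hF : IsFittingSet π Fm) (hG : HasBlockFactors π G) (K : Subgroup G) :
    ∃ V, IsInjectorIn Fm K V := by
  induction K using WellFoundedLT.induction with
  | _ K ih =>
  by_cases hK : K = ⊥
  · subst hK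
    refine ⟨⊥, le_rfl, fun S hS => ?_⟩
    obtain rfl := le_bot_iff.1 hS.le
    exact ⟨⟨inf_le_left, by simpa using hF.bot⟩, fun U hU _ => hU.1.trans (by simp)⟩
  · obtain ⟨N, hNK, hN, hidx⟩ := hG K hK
    obtain ⟨ρ, hρ, hidx⟩ := exists_block hidx
    obtain ⟨W, hW⟩ := ih N hNK
    obtain ⟨V, hWV, hV⟩ := exists_isMaximalIn (hW.1.trans hNK.le) hW.isMaximalIn.mem
    exact ⟨V, hF.isInjectorIn_of_isMaximalIn hG K hρ hNK.le hN hidx hW hWV hV⟩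

end IsFittingSet

end Injectors

/-! ### From composition factors to block factors. -/

section CompositionSeries

variable {G : Type u} [Group G]

lemma isSimpleGroup_quotient_of_maximal {N K : Subgroup G} [hn : (N.subgroupOf K).Normal]
    (hNK : N < K)
    (hmax : ∀ A, N < A → A < K → ¬ K ≤ normalizer (A : Set G)) :
    IsSimpleGroup (K ⧸ N.subgroupOf K) := by
  have hlt : ¬ K ≤ N := hNK.not_ge
  let φ : K →* K ⧸ N.subgroupOf K := QuotientGroup.mk' _
  have hφ : Function.Surjective φ := QuotientGroup.mk'_surjective _
  have hker : φ.ker = N.subgroupOf K := QuotientGroup.ker_mk' _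
  refine { exists_pair_ne := ?_, eq_bot_or_eq_top_of_normal := fun B hB => ?_ }
  · obtain ⟨x, hx, hxN⟩ := Set.not_subset.1 hlt
    refine ⟨φ ⟨x, hx⟩, 1, fun h => hxN ?_⟩
    have h1 : (⟨x, hx⟩ : K) ∈ φ.ker := MonoidHom.mem_ker.2 h
    rw [hker] at h1
    exact h1
  · have hcomap : (B.comap φ).Normal := hB.comap φ
    set A := (B.comap φ).map K.subtype with hA
    have hAK : A ≤ K := map_subtype_le _
    have hAB : A.subgroupOf K = B.comap φ := comap_map_eq_self_of_injective K.subtype_injective _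
    have hAn : K ≤ normalizer (A : Set G) := by
      rw [← normal_subgroupOf_iff_le_normalizer hAK, hAB]
      exact hcomap
    have hNA : N ≤ A := by
      intro x hx
      refine ⟨⟨x, hNK.le hx⟩, ?_, rfl⟩
      have h1 : (⟨x, hNK.le hx⟩ : K) ∈ φ.ker := by rw [hker]; exact hx
      change φ _ ∈ B
      rw [MonoidHom.mem_ker.1 h1]
      exact one_mem _
    have hB' : B = (A.subgroupOf K).map φ := by
      rw [hAB, map_comap_eq_self_of_surjective hφ]
    by_cases h1 : N = A
    · left
      rw [hB', ← h1]
      exact (Subgroup.map_eq_bot_iff _).2 hker.ge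
    · right
      have h2 : A = K := by
        by_contra h
        exact hmax A (lt_of_le_of_ne hNA h1) (lt_of_le_of_ne hAK h) hAn
      rw [hB', h2, subgroupOf_self, ← MonoidHom.range_eq_map, MonoidHom.range_eq_top.2 hφ]

lemma exists_isCompositionSeries_to [Finite G] (K : Subgroup G) :
    ∃ (n : ℕ) (s : Fin (n + 1) → Subgroup G), s 0 = ⊥ ∧ s (Fin.last n) = K ∧
      ∀ i : Fin n, s i.castSucc ≤ s i.succ ∧
        ∃ _ : ((s i.castSucc).subgroupOf (s i.succ)).Normal,
          IsSimpleGroup (s i.succ ⧸ (s i.castSucc).subgroupOf (s i.succ)) := by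
  induction K using WellFoundedLT.induction with
  | _ K ih =>
  by_cases hK : K = ⊥
  · exact ⟨0, fun _ => ⊥, rfl, hK.symm, fun i => i.elim0⟩
  obtain ⟨N, -, ⟨hNK, hN⟩, hmax⟩ := Finite.exists_le_maximal
    (p := fun N : Subgroup G => N < K ∧ K ≤ normalizer (N : Set G)) (a := ⊥)
    ⟨bot_lt_iff_ne_bot.2 hK, le_normalizer_of_normal⟩
  obtain ⟨n, s, h0, hl, hs⟩ := ih N hNK
  have hn : (N.subgroupOf K).Normal := normal_subgroupOf_of_le_normalizer hN
  refine ⟨n + 1, Fin.snoc (α := fun _ => Subgroup G) s K, ?_, ?_, fun i => ?_⟩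
  · rw [← Fin.castSucc_zero, Fin.snoc_castSucc, h0]
  · rw [Fin.snoc_last]
  · induction i using Fin.lastCases with
    | last =>
      rw [Fin.snoc_castSucc, Fin.succ_last, Fin.snoc_last, hl]
      exact ⟨hNK.le, hn, isSimpleGroup_quotient_of_maximal hNK fun A h1 h2 h3 =>
        h1.not_ge (hmax ⟨h2, h3⟩ h1.le)⟩
    | cast i =>
      rw [Fin.snoc_castSucc, Fin.succ_castSucc, Fin.snoc_castSucc]
      exact hs i

lemma natCard_eq_of_isSimpleGroup_of_isPGroup {p : Nat.Primes} {Q : Type u} [Group Q] [Finite Q]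
    [IsSimpleGroup Q] (h : IsPGroup (p : ℕ) Q) : Nat.card Q = p := by
  have := Fact.mk p.2
  have := h.isNilpotent
  have hcomm : ∀ a b : Q, a * b = b * a := IsSimpleGroup.comm_iff_isSolvable.2 inferInstance
  let _ : CommGroup Q := { ‹Group Q› with mul_comm := hcomm }
  obtain ⟨k, hk⟩ := IsPGroup.iff_card.1 h
  have hp : (Nat.card Q).Prime := IsSimpleGroup.prime_card
  have hk' := hk ▸ hp
  rw [hk, (Nat.Prime.eq_one_of_pow hk'), pow_one]

lemma isPiNumber_of_mem {ρ : Set Nat.Primes} {X : Type u} [Group X] (h : (piGroups ρ).Mem X) :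
    IsPiNumber ρ (Nat.card X) := h.2

/-- Intersect `K` with the last term of a composition series that does not contain it: the quotient
embeds in a composition factor, which is a `π`-group or has prime order outside `π`. -/
theorem hasBlockFactors_of_isPiSoluble {π : Set Nat.Primes} [Finite G] (hG : IsPiSoluble πᶜ G) :
    HasBlockFactors π G := by
  obtain ⟨n, s, h0, hl, hs⟩ := exists_isCompositionSeries_to (⊤ : Subgroup G)
  intro K hK
  obtain ⟨i, hi, hi'⟩ : ∃ i : Fin n, ¬ K ≤ s i.castSucc ∧ K ≤ s i.succ := by
    by_contra! h
    have : ∀ i, ¬ K ≤ s i := fun i => by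
      induction i using Fin.induction with
      | zero => rw [h0, le_bot_iff]; exact hK
      | succ i ih => exact h i ih
    exact this (Fin.last n) (hl ▸ le_top)
  obtain ⟨hle, hn, hsimple⟩ := hs i
  have hnorm : s i.succ ≤ normalizer (s i.castSucc : Set G) :=
    (normal_subgroupOf_iff_le_normalizer hle).1 hn
  have hfac : IsCompositionFactor (s i.succ ⧸ (s i.castSucc).subgroupOf (s i.succ)) G :=
    ⟨n, s, ⟨h0, hl, hs⟩, i, hn, ⟨MulEquiv.refl _⟩⟩
  have hcard : (s i.castSucc).relIndex (s i.succ) =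
    Nat.card (s i.succ ⧸ (s i.castSucc).subgroupOf (s i.succ)) := index_eq_card _
  have hdvd : (K ⊓ s i.castSucc).relIndex K ∣ (s i.castSucc).relIndex (s i.succ) := by
    rw [inf_relIndex_left]
    exact relIndex_dvd_of_le_normalizer hi' hnorm
  refine ⟨K ⊓ s i.castSucc, inf_lt_left.2 hi,
    le_normalizer_inf le_normalizer (hi'.trans hnorm), ?_⟩
  by_cases hp : (piGroups πᶜ).Mem (s i.succ ⧸ (s i.castSucc).subgroupOf (s i.succ))
  · right
    obtain ⟨p, hp, hpQ⟩ := hG.2 _ hfac hp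
    refine ⟨p, hp, ?_⟩
    rw [hcard, natCard_eq_of_isSimpleGroup_of_isPGroup hpQ] at hdvd
    refine ((Nat.dvd_prime p.2).1 hdvd).resolve_left fun h => ?_
    exact hi ((relIndex_eq_one.1 h).trans inf_le_right)
  · left
    have := isPiNumber_of_mem ((hG.1 _ hfac).resolve_left hp)
    rw [compl_compl, ← hcard] at this
    exact this.of_dvd hdvd

end CompositionSeries

/-! ### The residual `O^ρ`. -/

section UpperO

variable {ρ : Set Nat.Primes} {G : Type u} [Group G] [Finite G]

lemma mem_piGroups_quotient_iff {N : Subgroup G} [N.Normal] :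
    (piGroups ρ).Mem (G ⧸ N) ↔ IsPiNumber ρ N.index := by
  rw [index_eq_card]
  exact ⟨fun h => h.2, fun h => ⟨inferInstance, h⟩⟩

lemma residual_le {N : Subgroup G} [hN : N.Normal] (h : IsPiNumber ρ N.index) :
    residual (piGroups ρ) G ≤ N := sInf_le ⟨hN, mem_piGroups_quotient_iff.2 h⟩

lemma residual_spec :
    (residual (piGroups ρ) G).Normal ∧ IsPiNumber ρ (residual (piGroups ρ) G).index := by
  obtain ⟨N, -, ⟨hN, hidx⟩, hmin⟩ := Finite.exists_le_minimal
    (p := fun N : Subgroup G => N.Normal ∧ IsPiNumber ρ N.index) (a := ⊤)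
    ⟨inferInstance, by rw [index_top]; exact isPiNumber_one⟩
  have : residual (piGroups ρ) G = N := by
    refine le_antisymm (residual_le hidx) (le_sInf ?_)
    rintro A ⟨hA, hAm⟩
    have h1 : IsPiNumber ρ (N ⊓ A).index := by
      rw [← relIndex_top_right]
      refine isPiNumber_relIndex_inf le_normalizer_of_normal ?_ ?_
      · rwa [relIndex_top_right]
      · rw [relIndex_top_right]; exact mem_piGroups_quotient_iff.1 hAm
    exact (hmin ⟨normal_inf_normal N A, h1⟩ inf_le_left).trans inf_le_right
  rw [this]
  exact ⟨hN, hidx⟩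

omit [Finite G] in
lemma upperO_le (H : Subgroup G) : upperO ρ H ≤ H := map_subtype_le _

omit [Finite G] in
lemma upperO_subgroupOf (H : Subgroup G) :
    (upperO ρ H).subgroupOf H = residual (piGroups ρ) H :=
  comap_map_eq_self_of_injective H.subtype_injective _

lemma le_normalizer_upperO (H : Subgroup G) : H ≤ normalizer (upperO ρ H : Set G) := by
  rw [← normal_subgroupOf_iff_le_normalizer (upperO_le H), upperO_subgroupOf]
  exact residual_spec.1

lemma isPiNumber_upperO (H : Subgroup G) : IsPiNumber ρ ((upperO ρ H).relIndex H) := by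
  rw [relIndex, upperO_subgroupOf]
  exact residual_spec.2

lemma upperO_le_of_isPiNumber {N H : Subgroup G} (hN : H ≤ normalizer (N : Set G))
    (h : IsPiNumber ρ (N.relIndex H)) : upperO ρ H ≤ N := by
  have : (N.subgroupOf H).Normal := normal_subgroupOf_of_le_normalizer hN
  calc upperO ρ H ≤ (N.subgroupOf H).map H.subtype := Subgroup.map_mono (residual_le h)
    _ ≤ N := by rw [subgroupOf_map_subtype]; exact inf_le_left

lemma conj_smul_upperO_ge (g : G) (H : Subgroup G) :
    upperO ρ (MulAut.conj g • H) ≤ MulAut.conj g • upperO ρ H := by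
  refine upperO_le_of_isPiNumber ?_ ?_
  · rw [normalizer_conj_smul]
    exact pointwise_smul_le_pointwise_smul_iff.2 (le_normalizer_upperO H)
  · rw [relIndex_pointwise_smul]
    exact isPiNumber_upperO H

lemma normalizer_le_normalizer_upperO (H : Subgroup G) :
    normalizer (H : Set G) ≤ normalizer (upperO ρ H : Set G) := by
  intro g hg
  have h1 := conj_smul_upperO_ge (ρ := ρ) g H
  rw [conj_smul_eq hg] at h1
  exact mem_normalizer_iff_conj_smul.2
    (Subgroup.eq_of_le_of_card_ge h1 (card_conj_smul _ _).le).symm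

/-- All subgroups between a normal subgroup of `ρ`-index and the group thus share one `O^ρ`, which
is what makes them Dnormal. -/
lemma upperO_eq_of_isPiNumber {D U : Subgroup G} (hDU : D ≤ U) (hD : U ≤ normalizer (D : Set G))
    (h : IsPiNumber ρ (D.relIndex U)) : upperO ρ U = upperO ρ D := by
  apply le_antisymm
  · refine upperO_le_of_isPiNumber (hD.trans (normalizer_le_normalizer_upperO D)) ?_
    rw [← relIndex_mul_relIndex _ D U (upperO_le D) hDU]
    exact (isPiNumber_upperO D).mul h
  · refine (upperO_le_of_isPiNumber (N := upperO ρ U ⊓ D) (le_normalizer_inf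
      (hDU.trans (le_normalizer_upperO U)) le_normalizer) ?_).trans inf_le_left
    rw [inf_relIndex_right]
    exact (isPiNumber_upperO U).of_dvd (relIndex_dvd_of_le_normalizer hDU (le_normalizer_upperO U))

end UpperO

/-! ### Sources of Dnormal subgroups. -/

section DNormal

variable {π : Set Nat.Primes} {G : Type u} [Group G] [Finite G]

lemma isDNormal_of_normal (N : Subgroup G) [N.Normal] : IsDNormal π N :=
  ⟨fun _ _ _ _ => le_normalizer_of_normal, fun _ _ _ _ => ⟨fun _ => le_normalizer_of_normal,
    fun _ => (le_normalizer_of_normal (H := N)).trans (normalizer_le_normalizer_upperO N)⟩⟩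

lemma not_eq_singleton_of_two_le_encard (hπ : 2 ≤ π.encard) (p : Nat.Primes) : π ≠ {p} := by
  rintro rfl
  rw [Set.encard_singleton] at hπ
  exact absurd hπ (by norm_num)

lemma eq_empty_or_singleton_or_two_le_encard (π : Set Nat.Primes) :
    (π = ∅ ∨ ∃ p, π = {p}) ∨ 2 ≤ π.encard := by
  by_cases h : π.encard ≤ 1
  · exact Or.inl (Set.encard_le_one_iff_eq.1 h)
  · right
    rw [not_le] at h
    exact Order.add_one_le_of_lt h

lemma sylow_le_of_isPiNumber_index {p : Nat.Primes} (hp : p ∉ π) (P : Sylow (p : ℕ) G)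
    {D : Subgroup G} [D.Normal] (hD : IsPiNumber π D.index) : (P : Subgroup G) ≤ D := by
  have h1 : IsPiNumber {p} (D.relIndex P) :=
    (isPiNumber_natCard_iff.2 P.2).of_dvd (relIndex_dvd_card _ _)
  have h2 : IsPiNumber {p}ᶜ (D.relIndex P) :=
    (hD.of_dvd (relIndex_dvd_index_of_normal _ _)).mono (Set.subset_compl_singleton_iff.2 hp)
  exact relIndex_eq_one.1 (h1.eq_one h2)

/-- If `π` has at least two elements, every subgroup containing a normal subgroup of `π`-index is
Dnormal. -/
lemma isDNormal_of_normal_le (hπ : 2 ≤ π.encard) {D U : Subgroup G} [D.Normal] (hDU : D ≤ U)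
    (hD : IsPiNumber π D.index) : IsDNormal π U := by
  refine ⟨fun p hp P _ => (sylow_le_of_isPiNumber_index hp P hD).trans (hDU.trans le_normalizer),
    fun p _ P _ => ⟨fun h => absurd h (not_eq_singleton_of_two_le_encard hπ p), fun _ => ?_⟩⟩
  rw [upperO_eq_of_isPiNumber hDU le_normalizer_of_normal
    (hD.of_dvd (relIndex_dvd_index_of_normal _ _))]
  exact (le_normalizer_of_normal (H := D)).trans (normalizer_le_normalizer_upperO D)

end DNormal

/-! ### Growth of normalizers in sections of prime power order. -/

section PGroups

variable {G : Type u} [Group G] [Finite G]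

/-- Normalizers grow above a normal subgroup of prime power index. -/
lemma exists_mem_normalizer_notMem {p : Nat.Primes} {D A H : Subgroup G} (hDA : D ≤ A) (hAH : A < H)
    (hD : H ≤ normalizer (D : Set G)) (hidx : IsPiNumber {p} (D.relIndex H)) :
    ∃ h ∈ H, h ∈ normalizer (A : Set G) ∧ h ∉ A := by
  have := Fact.mk p.2
  have hDn : (D.subgroupOf H).Normal := normal_subgroupOf_of_le_normalizer hD
  let φ : H →* H ⧸ D.subgroupOf H := QuotientGroup.mk' _
  have hφ : Function.Surjective φ := QuotientGroup.mk'_surjective _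
  have hker : φ.ker = D.subgroupOf H := QuotientGroup.ker_mk' _
  have hp : IsPGroup (p : ℕ) (H ⧸ D.subgroupOf H) := by
    obtain ⟨k, hk⟩ := hidx.eq_prime_pow (relIndex_ne_zero' _ _)
    rw [relIndex, index_eq_card] at hk
    exact IsPGroup.of_card hk
  have := hp.isNilpotent
  have hcomap : ((A.subgroupOf H).map φ).comap φ = A.subgroupOf H := by
    rw [comap_map_eq, hker, sup_eq_left]
    exact fun x hx => hDA hx
  have hlt : (A.subgroupOf H).map φ < ⊤ := by
    rw [lt_top_iff_ne_top]
    intro h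
    rw [h, comap_top] at hcomap
    exact hAH.not_ge (subgroupOf_eq_top.1 hcomap.symm)
  obtain ⟨q, hq, hqA⟩ := SetLike.exists_of_lt (Group.normalizerCondition_of_isNilpotent _ hlt)
  obtain ⟨h, rfl⟩ := hφ q
  rw [← mem_comap] at hq hqA
  rw [comap_normalizer_eq_of_surjective _ hφ, hcomap, ← subgroupOf_normalizer_eq hAH.le] at hq
  rw [hcomap] at hqA
  exact ⟨h, h.2, hq, hqA⟩

end PGroups

/-! ### Members of a Fitting class inside one group form a Fitting set. -/

section FittingClasses

variable {π : Set Nat.Primes} {F : GroupClass.{u}} {G : Type u} [Group G]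

lemma mem_subgroupOf_iff {U N : Subgroup G} (h : N ≤ U) : F.Mem (N.subgroupOf U) ↔ F.Mem N :=
  ⟨F.mem_of_mulEquiv _ _ (subgroupOfEquivOfLe h), F.mem_of_mulEquiv _ _ (subgroupOfEquivOfLe h).symm⟩

variable [Finite G]

namespace IsNPiFittingClass

omit [Finite G] in
lemma mem_bot (hF : IsNPiFittingClass π F) : F.Mem (⊥ : Subgroup G) := by
  obtain ⟨X, _, hX⟩ := hF.nonempty
  have := F.finite_of_mem X hX
  refine F.mem_of_mulEquiv _ _ ?_ (hF.mem_of_isDNormal X hX ⊥ (isDNormal_of_normal ⊥))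
  exact MulEquiv.ofUnique

omit [Finite G] in
lemma mem_conj (g : G) {U : Subgroup G} (hU : F.Mem U) :
    F.Mem (MulAut.conj g • U : Subgroup G) :=
  F.mem_of_mulEquiv _ _ (Subgroup.equivSMul (MulAut.conj g) U) hU

lemma mem_of_normal (hF : IsNPiFittingClass π F) {U N : Subgroup G} (hU : F.Mem U) (hNU : N ≤ U)
    (hN : U ≤ normalizer (N : Set G)) : F.Mem N := by
  have : (N.subgroupOf U).Normal := normal_subgroupOf_of_le_normalizer hN
  exact (mem_subgroupOf_iff hNU).1 (hF.mem_of_isDNormal U hU _ (isDNormal_of_normal _))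

lemma mem_sup_of_isDNormal (hF : IsNPiFittingClass π F) {M N : Subgroup G} (hM : F.Mem M)
    (hN : F.Mem N) (hMd : IsDNormal π (M.subgroupOf (M ⊔ N)))
    (hNd : IsDNormal π (N.subgroupOf (M ⊔ N))) : F.Mem (M ⊔ N : Subgroup G) := by
  refine hF.mem_of_join _ _ _ hMd hNd ?_ ((mem_subgroupOf_iff le_sup_left).2 hM)
    ((mem_subgroupOf_iff le_sup_right).2 hN)
  rw [← subgroupOf_sup le_sup_left le_sup_right, subgroupOf_self]

lemma mem_sup (hF : IsNPiFittingClass π F) {M N : Subgroup G} (hM : F.Mem M)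
    (hN : F.Mem N) (hMN : M ≤ normalizer (N : Set G)) (hNM : N ≤ normalizer (M : Set G)) :
    F.Mem (M ⊔ N : Subgroup G) := by
  have h1 : (M.subgroupOf (M ⊔ N)).Normal :=
    normal_subgroupOf_of_le_normalizer (sup_le le_normalizer hNM)
  have h2 : (N.subgroupOf (M ⊔ N)).Normal :=
    normal_subgroupOf_of_le_normalizer (sup_le hMN le_normalizer)
  exact hF.mem_sup_of_isDNormal hM hN (isDNormal_of_normal _) (isDNormal_of_normal _)

/-- `U` need not be subnormal in `V`: Dnormality gives more closure than an ordinary Fitting class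
has. -/
lemma mem_of_isPiNumber (hF : IsNPiFittingClass π F) (hπ : 2 ≤ π.encard) {D U V : Subgroup G}
    (hV : F.Mem V) (hDU : D ≤ U) (hUV : U ≤ V) (hD : V ≤ normalizer (D : Set G))
    (hidx : IsPiNumber π (D.relIndex V)) : F.Mem U := by
  have : (D.subgroupOf V).Normal := normal_subgroupOf_of_le_normalizer hD
  exact (mem_subgroupOf_iff hUV).1 (hF.mem_of_isDNormal V hV _
    (isDNormal_of_normal_le hπ (D := D.subgroupOf V) (fun x hx => hDU hx) hidx))

lemma mem_sup_of_isPiNumber (hF : IsNPiFittingClass π F) (hπ : 2 ≤ π.encard)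
    {D U V H : Subgroup G} (hD : H ≤ normalizer (D : Set G)) (hDU : D ≤ U) (hDV : D ≤ V)
    (hUH : U ≤ H) (hVH : V ≤ H) (hidx : IsPiNumber π (D.relIndex H)) (hU : F.Mem U)
    (hV : F.Mem V) : F.Mem (U ⊔ V : Subgroup G) := by
  have hH : U ⊔ V ≤ H := sup_le hUH hVH
  have : (D.subgroupOf (U ⊔ V)).Normal := normal_subgroupOf_of_le_normalizer (hH.trans hD)
  have hidx' : IsPiNumber π (D.subgroupOf (U ⊔ V)).index :=
    hidx.of_dvd (relIndex_dvd_of_le_normalizer hH hD)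
  exact hF.mem_sup_of_isDNormal hU hV
    (isDNormal_of_normal_le hπ (D := D.subgroupOf (U ⊔ V)) (fun x hx => hDU hx) hidx')
    (isDNormal_of_normal_le hπ (D := D.subgroupOf (U ⊔ V)) (fun x hx => hDV hx) hidx')

/-- A maximal member above a normal subgroup of prime power index is normal. -/
lemma le_normalizer_of_isMaximalIn (hF : IsNPiFittingClass π F) {p : Nat.Primes}
    {D H V : Subgroup G} (hD : H ≤ normalizer (D : Set G)) (hDV : D ≤ V)
    (hidx : IsPiNumber {p} (D.relIndex H)) (hV : IsMaximalIn (fun U => F.Mem U) H V) :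
    H ≤ normalizer (V : Set G) := by
  by_contra hnot
  have hlt : H ⊓ normalizer (V : Set G) < H := inf_lt_left.2 hnot
  have hVA : V ≤ H ⊓ normalizer (V : Set G) := le_inf hV.le le_normalizer
  -- `h` normalizes `N_H(V)`, so `V` and its conjugate by `h` are both normal there and their
  -- product is a member; maximality forces `h` to normalize `V`.
  obtain ⟨h, hh, hhA, hhn⟩ := exists_mem_normalizer_notMem (hDV.trans hVA) hlt hD hidx
  have h1 : V ≤ normalizer ((MulAut.conj h • V : Subgroup G) : Set G) := by
    rw [normalizer_conj_smul]
    exact hVA.trans ((conj_smul_eq hhA).ge.trans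
      (pointwise_smul_le_pointwise_smul_iff.2 inf_le_right))
  have h2 : MulAut.conj h • V ≤ normalizer (V : Set G) :=
    (conj_smul_le hVA hhA).trans inf_le_right
  have h3 := hV.eq_of_le (sup_le hV.le (conj_smul_le hV.le (le_normalizer hh)))
    (hF.mem_sup hV.mem (mem_conj h hV.mem) h1 h2) le_sup_left
  have h4 : MulAut.conj h • V ≤ V := le_sup_right.trans h3.ge
  exact hhn ⟨hh, mem_normalizer_iff_conj_smul.2
    (Subgroup.eq_of_le_of_card_ge h4 (card_conj_smul _ _).ge)⟩

/-- The subgroups of a finite group that belong to an `𝔑^π`-Fitting class form a Fitting set. -/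
theorem isFittingSet (hF : IsNPiFittingClass π F) :
    IsFittingSet π (fun U : Subgroup G => F.Mem U) where
  bot := hF.mem_bot
  conj g _ hU := mem_conj g hU
  of_normal := hF.mem_of_normal
  sup := hF.mem_sup
  unique := by
    intro ρ hρ D H U V hD hDU hDV hidx hU hV
    have hsup : F.Mem (U ⊔ V : Subgroup G) → U = V := fun h =>
      (hU.eq_of_le (sup_le hU.le hV.le) h le_sup_left).trans
        (hV.eq_of_le (sup_le hU.le hV.le) h le_sup_right).symm
    have hprime : ∀ p : Nat.Primes, IsPiNumber {p} (D.relIndex H) → U = V := fun p hp =>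
      hsup (hF.mem_sup hU.mem hV.mem
        (hU.le.trans (hF.le_normalizer_of_isMaximalIn hD hDV hp hV))
        (hV.le.trans (hF.le_normalizer_of_isMaximalIn hD hDU hp hU)))
    obtain rfl | ⟨p, -, rfl⟩ := hρ
    · obtain (rfl | ⟨p, rfl⟩) | hπ := eq_empty_or_singleton_or_two_le_encard ρ
      -- For `π = ∅` the index is 1, and any prime would serve.
      · exact hprime ⟨2, Nat.prime_two⟩ (hidx.mono (Set.empty_subset _))
      · exact hprime p hidx
      · exact hsup (hF.mem_sup_of_isPiNumber hπ hD hDU hDV hU.le hV.le hidx hU.mem hV.mem)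
    · exact hprime p hidx

end IsNPiFittingClass

end FittingClasses

/-! ### Injectors and Dnormal subgroups. -/

section Intersections

variable {π : Set Nat.Primes} {G : Type u} [Group G] [Finite G]

omit [Finite G] in
lemma exists_sylow_reducesInto (p : Nat.Primes) (H : Subgroup G) :
    ∃ P : Sylow (p : ℕ) G, ReducesInto P H := by
  have := Fact.mk p.2
  obtain ⟨Q⟩ : Nonempty (Sylow p H) := inferInstance
  obtain ⟨P, hP⟩ := (Q.2.map H.subtype).exists_le_sylow
  refine ⟨P, Q, (Q.3 (P.2.comap_of_injective _ H.subtype_injective) ?_).symm⟩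
  exact map_le_iff_le_comap.1 hP

lemma eq_top_of_forall_exists_sylow_le {A : Subgroup G}
    (h : ∀ p : Nat.Primes, ∃ P : Sylow (p : ℕ) G, (P : Subgroup G) ≤ A) : A = ⊤ := by
  rw [← index_eq_one]
  by_contra hne
  obtain ⟨p, hp, hdvd⟩ := Nat.exists_prime_and_dvd hne
  have := Fact.mk hp
  obtain ⟨P, hP⟩ := h ⟨p, hp⟩
  exact P.not_dvd_index (hdvd.trans (index_dvd_of_le hP))

lemma IsDNormal.normal (hπ : π = ∅ ∨ ∃ p, π = {p}) {N : Subgroup G} (hN : IsDNormal π N) :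
    N.Normal := by
  rw [← normalizer_eq_top_iff]
  refine eq_top_of_forall_exists_sylow_le fun p => ?_
  obtain ⟨P, hP⟩ := exists_sylow_reducesInto p N
  refine ⟨P, ?_⟩
  by_cases hp : p ∈ π
  · refine (hN.2 p hp P hP).1 ?_
    obtain rfl | ⟨q, rfl⟩ := hπ
    · exact absurd hp (Set.notMem_empty p)
    · rw [Set.mem_singleton_iff.1 hp]
  · exact hN.1 p hp P hP

/-- For each prime some Sylow subgroup reduces into `N`, so the normalizer of `O^π(N)` contains a
full Sylow subgroup for every prime. -/
lemma IsDNormal.normal_upperO (hπ : 2 ≤ π.encard) {N : Subgroup G} (hN : IsDNormal π N) :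
    (upperO π N).Normal := by
  rw [← normalizer_eq_top_iff]
  refine eq_top_of_forall_exists_sylow_le fun p => ?_
  obtain ⟨P, hP⟩ := exists_sylow_reducesInto p N
  refine ⟨P, ?_⟩
  by_cases hp : p ∈ π
  · exact (hN.2 p hp P hP).2 hπ
  · exact (hN.1 p hp P hP).trans (normalizer_le_normalizer_upperO N)

/-- For `p ∉ π` every Sylow `p`-subgroup reduces into `N`: it meets the normal subgroup `O^π(N)` in
a Sylow subgroup, and `|N : O^π(N)|` is prime to `p`. -/
lemma IsDNormal.sylow_le_normalizer (hπ : 2 ≤ π.encard) {N : Subgroup G} (hN : IsDNormal π N)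
    {p : Nat.Primes} (hp : p ∉ π) (P : Sylow (p : ℕ) G) :
    (P : Subgroup G) ≤ normalizer (N : Set G) := by
  have := Fact.mk p.2
  have hR := hN.normal_upperO hπ
  refine hN.1 p hp P ?_
  have hQ : IsPGroup (p : ℕ) ((P : Subgroup G).subgroupOf N) :=
    P.2.comap_of_injective _ N.subtype_injective
  have hndvd : ¬ (p : ℕ) ∣ ((P : Subgroup G).subgroupOf N).index := by
    intro h
    have h1 : (p : ℕ) ∣ ((P : Subgroup G) ⊓ upperO π N).relIndex N :=
      h.trans (relIndex_dvd_of_le_left _ inf_le_left)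
    rw [← relIndex_mul_relIndex _ (upperO π N) N inf_le_right (upperO_le N),
      inf_relIndex_right] at h1
    obtain h2 | h2 := (Nat.Prime.dvd_mul p.2).1 h1
    · rw [← relIndex_sup_of_le_normalizer' le_normalizer_of_normal] at h2
      exact P.not_dvd_index (h2.trans (relIndex_dvd_index_of_le le_sup_left))
    · exact hp (isPiNumber_upperO N p h2)
  exact ⟨hQ.toSylow hndvd, rfl⟩

/-- If `π` has at least two elements, a Dnormal subgroup is normalized by some normal subgroup of
`π`-index. -/
lemma IsDNormal.isPiNumber_index_normalCore (hπ : 2 ≤ π.encard) {N : Subgroup G}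
    (hN : IsDNormal π N) : IsPiNumber π (normalizer (N : Set G)).normalCore.index := by
  intro p hp
  by_contra hpπ
  have := Fact.mk p.2
  obtain ⟨P⟩ : Nonempty (Sylow (p : ℕ) G) := inferInstance
  have hle : (P : Subgroup G) ≤ (normalizer (N : Set G)).normalCore := by
    intro x hx g
    exact hN.sylow_le_normalizer hπ hpπ (g • P) (conj_mem_conj_smul.2 hx)
  exact P.not_dvd_index (hp.trans (index_dvd_of_le hle))

variable {F : GroupClass.{u}}

/-- `I ⊓ S` lies above the injector `I ⊓ A` of `A`, so only its maximality in `S` is at stake. A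
maximal member of `K = G` above a larger `Y ≤ S` is conjugate to `I` by some `a ∈ A ≤ S`, whence
`Y^a ≤ I ⊓ S` and the orders agree. -/
lemma IsInjectorIn.inf_of_isPiNumber (hF : IsNPiFittingClass π F) (hG : HasBlockFactors π G)
    (hπ : 2 ≤ π.encard) {A S I : Subgroup G} [A.Normal] (hA : IsPiNumber π A.index) (hAS : A ≤ S)
    (hI : IsInjectorIn (fun U : Subgroup G => F.Mem U) ⊤ I) :
    IsInjectorIn (fun U : Subgroup G => F.Mem U) S (I ⊓ S) := by
  have hFs := hF.isFittingSet (G := G)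
  have hW := hI.inf (N := A) le_top le_normalizer_of_normal
  have hidx : ∀ B : Subgroup G, IsPiNumber π (A.relIndex B) := fun B =>
    hA.of_dvd (relIndex_dvd_index_of_normal _ _)
  have hWIS : I ⊓ A ≤ I ⊓ S := inf_le_inf_left I hAS
  have hmem : F.Mem (I ⊓ S : Subgroup G) := by
    refine hF.mem_of_isPiNumber hπ hI.isMaximalIn.mem hWIS inf_le_left
      (le_normalizer_inf le_normalizer le_normalizer_of_normal) ?_
    rw [inf_relIndex_left]
    exact hidx I
  refine hFs.isInjectorIn_of_isMaximalIn hG S (Or.inl rfl) hAS le_normalizer_of_normal (hidx S) hW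
    hWIS ?_
  obtain ⟨Y, hISY, hY⟩ := exists_isMaximalIn (Fm := fun U : Subgroup G => F.Mem U)
    (inf_le_right : I ⊓ S ≤ S) hmem
  obtain ⟨V, hYV, hV⟩ := exists_isMaximalIn (Fm := fun U : Subgroup G => F.Mem U)
    (le_top : Y ≤ ⊤) hY.mem
  obtain ⟨a, ha, hconj⟩ := hFs.exists_conj_of_normal hG (Or.inl rfl) le_normalizer_of_normal
    (hidx ⊤) le_top hW.isMaximalIn hV hI.isMaximalIn (hWIS.trans (hISY.trans hYV)) inf_le_left
  have h1 : MulAut.conj a • Y ≤ I ⊓ S :=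
    le_inf (hconj ▸ pointwise_smul_le_pointwise_smul_iff.2 hYV)
      (conj_smul_le hY.le (le_normalizer (hAS ha)))
  have h2 : I ⊓ S = Y := by
    refine Subgroup.eq_of_le_of_card_ge hISY ?_
    rw [← card_conj_smul a Y]
    exact Subgroup.card_le_of_le h1
  rwa [h2]

/-- Injectors of `G` restrict to injectors of Dnormal subgroups. -/
theorem IsInjectorIn.inf_of_isDNormal (hF : IsNPiFittingClass π F) (hG : HasBlockFactors π G)
    {N I : Subgroup G} (hI : IsInjectorIn (fun U : Subgroup G => F.Mem U) ⊤ I)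
    (hN : IsDNormal π N) : IsInjectorIn (fun U : Subgroup G => F.Mem U) N (I ⊓ N) := by
  obtain hπ | hπ := eq_empty_or_singleton_or_two_le_encard π
  · have := hN.normal hπ
    exact hI.inf le_top le_normalizer_of_normal
  · have h1 := IsInjectorIn.inf_of_isPiNumber (S := N ⊔ (normalizer (N : Set G)).normalCore) hF hG hπ
      (hN.isPiNumber_index_normalCore hπ) le_sup_right hI
    have h2 := h1.inf (N := N) le_sup_left (sup_le le_normalizer (normalCore_le _))
    rwa [inf_assoc, inf_eq_right.2 (le_sup_left : N ≤ N ⊔ _)] at h2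

end Intersections

/-! ### Relative and absolute notions of subnormality and injector. -/

section Translation

variable {F : GroupClass.{u}} {G : Type u} [Group G]

lemma SubnormalIn.isSubnormal {S K : Subgroup G} (h : SubnormalIn S K) (hK : K.IsSubnormal) :
    S.IsSubnormal := by
  induction h with
  | refl => exact hK
  | step h1 h2 _ ih => exact ih (.step _ _ h1 hK (normal_subgroupOf_of_le_normalizer h2))

lemma subnormalIn_map_of_isSubnormal {N : Subgroup G} {S : Subgroup N} (h : S.IsSubnormal) :
    SubnormalIn (S.map N.subtype) N := by
  induction h with
  | top =>
    rw [← MonoidHom.range_eq_map, range_subtype]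
    exact .refl
  | step H K hle _ hn ih =>
    refine ih.of_normal (map_mono hle) ?_
    exact (map_mono ((normal_subgroupOf_iff_le_normalizer hle).1 hn)).trans (le_normalizer_map _)

lemma isSubnormal_iff_subnormalIn_top {S : Subgroup G} : S.IsSubnormal ↔ SubnormalIn S ⊤ := by
  refine ⟨fun h => ?_, fun h => h.isSubnormal .top⟩
  induction h with
  | top => exact .refl
  | step H K hle _ hn ih =>
    exact ih.of_normal hle ((normal_subgroupOf_iff_le_normalizer hle).1 hn)

lemma isInjector_iff {V : Subgroup G} :
    IsInjector F V ↔ IsInjectorIn (fun U : Subgroup G => F.Mem U) ⊤ V :=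
  ⟨fun h => ⟨le_top, fun S hS => h S (isSubnormal_iff_subnormalIn_top.2 hS)⟩,
    fun h S hS => h.2 S (isSubnormal_iff_subnormalIn_top.1 hS)⟩

lemma mem_map_subtype_iff {N : Subgroup G} (U : Subgroup N) :
    F.Mem (U.map N.subtype) ↔ F.Mem U :=
  ⟨F.mem_of_mulEquiv _ _ (U.equivMapOfInjective _ N.subtype_injective).symm,
    F.mem_of_mulEquiv _ _ (U.equivMapOfInjective _ N.subtype_injective)⟩

lemma IsInjectorIn.isInjector_subgroupOf {N V : Subgroup G}
    (h : IsInjectorIn (fun U : Subgroup G => F.Mem U) N (V ⊓ N)) :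
    IsInjector F (V.subgroupOf N) := by
  intro S hS
  have hmax := h.2 _ (subnormalIn_map_of_isSubnormal hS)
  have heq : (V.subgroupOf N ⊓ S).map N.subtype = V ⊓ N ⊓ S.map N.subtype := by
    rw [map_inf _ _ _ N.subtype_injective, subgroupOf_map_subtype]
  rw [← heq] at hmax
  refine ⟨⟨inf_le_right, (mem_map_subtype_iff _).1 hmax.mem⟩, fun U hU hle => ?_⟩
  exact (map_le_map_iff_of_injective N.subtype_injective).1
    (hmax.2 ⟨map_mono hU.1, (mem_map_subtype_iff U).2 hU.2⟩ (map_mono hle))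

end Translation

/-! ### Conjugation by elements of the residual. -/

section Residual

variable {π : Set Nat.Primes} {G : Type u} [Group G]

/-- Elements of two normal subgroups of coprime indices that conjugate `V` to `V'` can be replaced
by an element of the intersection. -/
lemma exists_mem_inf_conj_smul_eq [Finite G] {N₁ N₂ V V' : Subgroup G} [N₁.Normal] [N₂.Normal]
    (hcop : Nat.Coprime N₁.index N₂.index) (h₁ : ∃ n ∈ N₁, MulAut.conj n • V = V')
    (h₂ : ∃ n ∈ N₂, MulAut.conj n • V = V') : ∃ n ∈ N₁ ⊓ N₂, MulAut.conj n • V = V' := by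
  obtain ⟨a, ha, haV⟩ := h₁
  obtain ⟨b, hb, hbV⟩ := h₂
  have hx : a⁻¹ * b ∈ normalizer (V : Set G) := by
    rw [mem_normalizer_iff_conj_smul, ← conj_smul_conj_smul, hbV, ← haV, conj_inv_smul_conj_smul]
  -- `x = a⁻¹ * b` normalizes `V`, so `a * x ^ k` conjugates `V` to `V'` for every `k`. Modulo `N₁`
  -- it should look like `a` (`k ≡ 0`), modulo `N₂` like `b` (`k ≡ 1`).
  obtain ⟨k, hk₁, hk₂⟩ := Nat.chineseRemainder hcop 0 1
  have key : ∀ (N : Subgroup G) [N.Normal] (m : ℕ), k ≡ m [MOD N.index] →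
      (((a⁻¹ * b) ^ k : G) : G ⧸ N) = (((a⁻¹ * b) ^ m : G) : G ⧸ N) := by
    intro N _ m hm
    rw [QuotientGroup.mk_pow, QuotientGroup.mk_pow, pow_eq_pow_iff_modEq]
    exact hm.of_dvd (by rw [index_eq_card]; exact orderOf_dvd_natCard _)
  refine ⟨a * (a⁻¹ * b) ^ k, ⟨N₁.mul_mem ha ?_, ?_⟩, ?_⟩
  · have := key N₁ 0 hk₁
    rwa [pow_zero, QuotientGroup.mk_one, QuotientGroup.eq_one_iff] at this
  · have := key N₂ 1 hk₂
    rw [pow_one, eq_comm, QuotientGroup.eq] at this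
    have h := N₂.mul_mem hb this
    rwa [mul_inv_rev, inv_inv, ← mul_assoc, mul_inv_cancel_left] at h
  · rw [← conj_smul_conj_smul, conj_smul_eq (pow_mem hx k), haV]

lemma residual_le_ker [Finite G] {ρ : Set Nat.Primes} {X : Type u} [Group X]
    (hX : IsPiNumber ρ (Nat.card X)) (f : G →* X) : residual (piGroups ρ) G ≤ f.ker := by
  refine residual_le ?_
  rw [index_ker]
  exact hX.of_dvd (card_subgroup_dvd_card _)

/-- A quotient in the class is a `π`-group times the product of the Sylow subgroups of a nilpotent
`π'`-group, and each factor is killed by the residual of its block. -/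
lemma le_residual_nPi [Finite G] {N : Subgroup G} (hπ : N ≤ residual (piGroups π) G)
    (hp : ∀ p ∉ π, (p : ℕ) ∣ Nat.card G → N ≤ residual (piGroups {p}) G) :
    N ≤ residual (nPi π) G := by
  refine le_sInf ?_
  rintro M ⟨hM, H, K, _, _, hH, hK, hnil, ⟨e⟩⟩ x hx
  have := hH.1
  have := hK.1
  let q : G →* H × K := e.toMonoidHom.comp (QuotientGroup.mk' M)
  have hq : Function.Surjective q := e.surjective.comp (QuotientGroup.mk'_surjective M)
  have h1 : (q x).1 = 1 := residual_le_ker hH.2 ((MonoidHom.fst H K).comp q) (hπ hx)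
  have h2 : (q x).2 = 1 := by
    obtain ⟨φ⟩ := (Group.isNilpotent_of_finite_tfae (G := K)).out 0 4 |>.1 hnil
    have h3 : φ.symm (q x).2 = 1 := by
      ext p P : 2
      have hpp := Nat.prime_of_mem_primeFactors p.2
      have := Fact.mk hpp
      have hpK := Nat.dvd_of_mem_primeFactors p.2
      have hpπ : (⟨p, hpp⟩ : Nat.Primes) ∉ π := hK.2 ⟨p, hpp⟩ hpK
      have hpG : (p : ℕ) ∣ Nat.card G := hpK.trans
        (card_dvd_of_surjective ((MonoidHom.snd H K).comp q) (Prod.snd_surjective.comp hq))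
      have hP : IsPiNumber {(⟨p, hpp⟩ : Nat.Primes)} (Nat.card P) :=
        isPiNumber_natCard_iff.2 P.2
      let f : G →* P := (Pi.evalMonoidHom _ P).comp ((Pi.evalMonoidHom _ p).comp
        (φ.symm.toMonoidHom.comp ((MonoidHom.snd H K).comp q)))
      exact residual_le_ker hP f (hp _ hpπ hpG hx)
    exact (map_eq_one_iff _ φ.symm.injective).1 h3
  have h3 : e (QuotientGroup.mk' M x) = 1 := Prod.ext h1 h2
  rw [map_eq_one_iff _ e.injective] at h3
  exact (QuotientGroup.eq_one_iff x).1 h3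

lemma exists_mem_residual_nPi_conj_smul_eq [Finite G] {V V' : Subgroup G}
    (h : ∀ ρ ∈ blocks π, ∃ n ∈ residual (piGroups ρ) G, MulAut.conj n • V = V') :
    ∃ n ∈ residual (nPi π) G, MulAut.conj n • V = V' := by
  -- One prime is added at a time, so that the index of `N` stays coprime to that of the next
  -- `O^p(G)`; only the primes dividing `|G|` are needed.
  have key : ∀ s : Finset Nat.Primes, (∀ p ∈ s, p ∉ π) → ∃ N : Subgroup G, N.Normal ∧
      IsPiNumber (π ∪ s) N.index ∧ N ≤ residual (piGroups π) G ∧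
      (∀ p ∈ s, N ≤ residual (piGroups {p}) G) ∧ ∃ n ∈ N, MulAut.conj n • V = V' := by
    intro s
    induction s using Finset.induction_on with
    | empty =>
      intro _
      exact ⟨_, residual_spec.1, residual_spec.2.mono Set.subset_union_left, le_rfl, by simp,
        h π (Or.inl rfl)⟩
    | insert p s hps ih =>
      intro hs
      have hpπ : p ∉ π := hs p (Finset.mem_insert_self p s)
      obtain ⟨N, hN, hidx, hNπ, hNs, hconj⟩ := ih fun q hq => hs q (Finset.mem_insert_of_mem hq)
      obtain ⟨hPn, hPidx⟩ := residual_spec (ρ := {p}) (G := G)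
      refine ⟨N ⊓ residual (piGroups {p}) G, normal_inf_normal _ _, ?_, inf_le_left.trans hNπ, ?_,
        exists_mem_inf_conj_smul_eq (hidx.coprime hPidx ?_) hconj (h _ (Or.inr ⟨p, hpπ, rfl⟩))⟩
      · rw [← relIndex_top_right]
        refine isPiNumber_relIndex_inf le_normalizer_of_normal ?_ ?_
        · rw [relIndex_top_right]
          exact hidx.mono (Set.union_subset_union_right _ (by simp))
        · rw [relIndex_top_right]
          exact hPidx.mono (by simp)
      · intro q hq
        obtain rfl | hq := Finset.mem_insert.1 hq
        · exact inf_le_right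
        · exact inf_le_left.trans (hNs q hq)
      · rw [Set.disjoint_singleton_right]
        rintro (hp | hp)
        · exact hpπ hp
        · exact hps hp
  have hfin : {p : Nat.Primes | p ∉ π ∧ (p : ℕ) ∣ Nat.card G}.Finite := by
    refine Set.Finite.of_finite_image (f := fun p : Nat.Primes => (p : ℕ)) ?_
      Subtype.val_injective.injOn
    refine (Nat.card G).primeFactors.finite_toSet.subset ?_
    rintro _ ⟨p, hp, rfl⟩
    exact Nat.mem_primeFactors.2 ⟨p.2, hp.2, Nat.card_pos.ne'⟩
  obtain ⟨N, -, -, hNπ, hNs, n, hn, hconj⟩ := key hfin.toFinset fun p hp =>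
    ((Set.Finite.mem_toFinset hfin).1 hp).1
  exact ⟨n, le_residual_nPi hNπ (fun p hp hpG => hNs p ((Set.Finite.mem_toFinset hfin).2 ⟨hp, hpG⟩))
    hn, hconj⟩

end Residual

end NPiFitting

theorem corollary2 (π : Set Nat.Primes) (F : NPiFitting.GroupClass.{u})
    (hF : NPiFitting.IsNPiFittingClass π F)
    (G : Type u) [Group G] [Finite G] (hG : NPiFitting.IsPiSoluble πᶜ G) :
    (∃ V₀ : Subgroup G, ∀ V : Subgroup G,
      NPiFitting.IsInjector F V ↔ ∃ g : G, V = NPiFitting.conjBy V₀ g) ∧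
    (∀ V V' : Subgroup G, NPiFitting.IsInjector F V → NPiFitting.IsInjector F V' →
      ∃ g ∈ NPiFitting.residual (NPiFitting.nPi π) G, NPiFitting.conjBy V' g = V) ∧
    (∀ I N : Subgroup G, NPiFitting.IsInjector F I → NPiFitting.IsDNormal π N →
      NPiFitting.IsInjector F (I.subgroupOf N)) := by
  have hB := NPiFitting.hasBlockFactors_of_isPiSoluble hG
  have hFs := hF.isFittingSet (G := G)
  refine ⟨?_, fun V V' hV hV' => ?_, fun I N hI hN => ?_⟩
  · obtain ⟨V₀, hV₀⟩ := hFs.exists_isInjectorIn hB ⊤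
    refine ⟨V₀, fun V => ⟨fun hV => ?_, ?_⟩⟩
    · obtain ⟨k, -, hk⟩ := hFs.exists_conj_eq hB ⊤ V₀ V hV₀ (NPiFitting.isInjector_iff.1 hV)
      exact ⟨k⁻¹, by rw [NPiFitting.conjBy, inv_inv, hk]⟩
    · rintro ⟨g, rfl⟩
      exact NPiFitting.isInjector_iff.2
        (hV₀.conj_self hFs (Subgroup.le_normalizer (Subgroup.mem_top g⁻¹)))
  · rw [NPiFitting.isInjector_iff] at hV hV'
    obtain ⟨n, hn, h⟩ := NPiFitting.exists_mem_residual_nPi_conj_smul_eq (π := π) (V := V')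
      (V' := V) fun ρ hρ => by
        obtain ⟨hnormal, hidx⟩ := NPiFitting.residual_spec (ρ := ρ) (G := G)
        refine hFs.exists_conj_eq_of_normal hB hρ le_top Subgroup.le_normalizer_of_normal ?_ hV' hV
        rwa [Subgroup.relIndex_top_right]
    exact ⟨n⁻¹, inv_mem hn, by rw [NPiFitting.conjBy, inv_inv, h]⟩
  · exact (NPiFitting.IsInjectorIn.inf_of_isDNormal hF hB
      (NPiFitting.isInjector_iff.1 hI) hN).isInjector_subgroupOf
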